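/- Let $n\ge 2$, $k=n-1$, and let $R(T)=\mathbb Z[e^{\pm a_1},\dots,e^{\pm a_n}]$, $b_i=1-e^{-a_i}$, with indices read modulo $n$. Let $\hat\Lambda_{R(T)}$ be the completed ring of symmetric functions in $y=(y_1,y_2,\dots)$ over $R(T)$, that is, the ring of symmetric formal power series in $y$ with coefficients in $R(T)$. For $1\le i\le n$ put $\Omega(b_i|y)=\prod_{j\ge1}(1-b_iy_j)^{-1}$. Write an element of $\hat\Lambda_{R(T)}$ as $f(y|b)$, and for $u\in S_n$ let $f(y|u(b))$ be obtained by applying $a_j\mapsto a_{u(j)}$ (hence $b_j\mapsto b_{u(j)}$) to the coefficients; let $\omega\in S_n$ be the rotation $j\mapsto j+1 \pmod n$. Let the extended affine Weyl group $\mathbb Z^n\rtimes S_n$ of $GL_n$ act on $\hat\Lambda_{R(T)}$ so that $u\in S_n$ sends $f(y|b)$ to $f(y|u(b))$ and the translation $t_{\varepsilon_i}$ is multiplication by $\Omega(b_i|y)$. Let $s_1,\dots,s_{n-1}$ be the simple transpositions, $s_0=t_{\varepsilon_1-\varepsilon_n}s_\theta$ with $s_\theta$ the transposition of $1$ and $n$,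 and $\hat W=\langle s_0,\dots,s_{n-1}\rangle$. For $i\in\mathbb Z/n\mathbb Z$ set $\alpha_i=a_i-a_{i+1}$ and $D_i=1+(1-e^{\alpha_i})^{-1}(s_i-1)$, an operator on $\hat\Lambda_{R(T)}$; for $w\in\hat W$ with reduced word $w=s_{i_1}\cdots s_{i_l}$ put $D_w=D_{i_1}\cdots D_{i_l}$, and define the closed $K$-theoretic double $k$-Schur function $\tilde g^{(k)}_w(y|b)=D_w(1)$. For a $k$-bounded partition $\lambda=(\lambda_1\ge\dots\ge\lambda_l>0)$, $\lambda_1\le k$, put $\tilde g^{(k)}_\lambda=\tilde g^{(k)}_{x_\lambda}$, where $x_\lambda=\pi_1^{-l+1}(\rho_{\lambda_l})\cdots\pi_1^{-1}(\rho_{\lambda_2})\rho_{\lambda_1}$, $\rho_p=s_{p-1}\cdots s_1s_0$, and $\pi_1$ is the automorphism $s_j\mapsto s_{j+1}$ of $\hat W$. Let $R_i=(i)^{n-i}$ be the rectangle with $n-i$ rows of length $i$, and let $\lambda\cup\mu$ be the partition whose multiset of parts is the union, with multiplicities, of those of $\lambda$ and $\mu$. Then for every $k$-bounded partition $\lambda$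 and every $1\le i\le n-1$, $$\tilde g^{(k)}_{\lambda\cup R_i}(y|b)=\tilde g^{(k)}_{R_i}(y|b)\cdot\tilde g^{(k)}_\lambda(y|\omega^i(b))\qquad\text{in }\hat\Lambda_{R(T)}.$$ -/

import Mathlib

open scoped AddMonoidAlgebra

namespace KSchur

/-! ### Completed symmetric functions -/

/-- `SymSeries A` is the completed ring of symmetric functions in `y = (y₀, y₁, …)` with coefficients
in `A`: all formal sums `f₀ + f₁ + ⋯` with `f_d` a symmetric function of degree `d` over `A`.
Equivalently, the formal power series in the `y_j` that are invariant under permuting the `y_j`. -/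
noncomputable def SymSeries (A : Type*) [CommRing A] : Subalgebra A (MvPowerSeries ℕ A) where
  carrier := {f | ∀ σ : Equiv.Perm ℕ, MvPowerSeries.renameEquiv A σ f = f}
  mul_mem' ha hb σ := by rw [map_mul, ha σ, hb σ]
  add_mem' ha hb σ := by rw [map_add, ha σ, hb σ]
  algebraMap_mem' r σ := AlgEquiv.commutes _ r

theorem coeff_rename_perm {A : Type*} [CommRing A] (σ : Equiv.Perm ℕ) (f : MvPowerSeries ℕ A)
    (m : ℕ →₀ ℕ) :
    MvPowerSeries.coeff (m.mapDomain σ) (MvPowerSeries.renameEquiv A σ f) =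
      MvPowerSeries.coeff m f := by
  have h := MvPowerSeries.coeff_embDomain_rename (e := σ.toEmbedding) f m
  rw [Finsupp.embDomain_eq_mapDomain] at h
  exact h

theorem mem_SymSeries_iff {A : Type*} [CommRing A] {f : MvPowerSeries ℕ A} :
    f ∈ SymSeries A ↔ ∀ (σ : Equiv.Perm ℕ) (m : ℕ →₀ ℕ),
      MvPowerSeries.coeff (m.mapDomain σ) f = MvPowerSeries.coeff m f := by
  constructor
  · intro hf σ m
    conv_lhs => rw [← hf σ]
    exact coeff_rename_perm σ f m
  · intro hf σ
    ext m
    obtain ⟨m, rfl⟩ : ∃ m', m = Finsupp.mapDomain σ m' := by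
      refine ⟨m.mapDomain σ.symm, ?_⟩
      rw [← Finsupp.mapDomain_comp]
      simp
    rw [coeff_rename_perm, hf σ m]

/-- Apply a ring homomorphism to the coefficients of a symmetric series. -/
noncomputable def symMap {A B : Type*} [CommRing A] [CommRing B] (φ : A →+* B) :
    SymSeries A →+* SymSeries B where
  toFun f := ⟨MvPowerSeries.map φ f.1, mem_SymSeries_iff.2 fun σ m => by
    rw [MvPowerSeries.coeff_map, MvPowerSeries.coeff_map, mem_SymSeries_iff.1 f.2 σ m]⟩
  map_one' := Subtype.ext (map_one _)
  map_zero' := Subtype.ext (map_zero _)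
  map_add' f g := Subtype.ext (map_add (MvPowerSeries.map φ) f.1 g.1)
  map_mul' f g := Subtype.ext (map_mul (MvPowerSeries.map φ) f.1 g.1)

/-- The infinite product `∏_j (1 - u y_j)⁻¹ = ∏_j ∑_e (u y_j)^e`: the coefficient of the monomial
`∏_j y_j ^ (m j)` is `∏_j u ^ (m j)`. -/
noncomputable def cauchySeries {A : Type*} [CommRing A] (u : A) : SymSeries A :=
  ⟨fun m => m.prod fun _ e => u ^ e, mem_SymSeries_iff.2 fun σ m => by
    change (m.mapDomain σ).prod (fun _ e => u ^ e) = m.prod (fun _ e => u ^ e)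
    exact Finsupp.prod_mapDomain_index_inj σ.injective⟩

theorem isUnit_cauchySeries {A : Type*} [CommRing A] (u : A) : IsUnit (cauchySeries u) := by
  have h1 : IsUnit (cauchySeries u).1 := by
    rw [MvPowerSeries.isUnit_iff_constantCoeff]
    have : MvPowerSeries.constantCoeff (cauchySeries u).1 = 1 := by
      change (0 : ℕ →₀ ℕ).prod (fun _ e => u ^ e) = 1
      exact Finsupp.prod_zero_index
    rw [this]
    exact isUnit_one
  obtain ⟨v, hv⟩ := h1
  have hinv : (↑v⁻¹ : MvPowerSeries ℕ A) ∈ SymSeries A := fun σ => by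
    apply v.mul_right_inj.1
    rw [Units.mul_inv]
    conv_lhs => rw [hv, ← (cauchySeries u).2 σ, ← hv]
    rw [← map_mul, Units.mul_inv, map_one]
  refine IsUnit.of_mul_eq_one ⟨_, hinv⟩ (Subtype.ext ?_)
  change (cauchySeries u).1 * _ = 1
  rw [← hv, Units.mul_inv]

/-! ### The torus and the Weyl groups of `GL_n`

The indices `1, …, n` are read modulo `n`; so the index `n` is the class `0`. -/

/-- The representation ring `R(T) = ℤ[X]` of the diagonal torus of `GL_n`, where `X = ⊕ ℤ a_i`. -/
abbrev RT (n : ℕ) : Type := ℤ[ZMod n → ℤ]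

/-- The exponential `e^l ∈ R(T)` of a character `l ∈ X`. -/
noncomputable def ex {n : ℕ} (l : ZMod n → ℤ) : RT n := AddMonoidAlgebra.single l 1

/-- The basis vector `a_i` of `X` (also used for the dual basis vector `ε_i` of `X^∨`). -/
def bas {n : ℕ} (i : ZMod n) : ZMod n → ℤ := Pi.single i 1

/-- `b_i = 1 - e^{-a_i}`. -/
noncomputable def b {n : ℕ} (i : ZMod n) : RT n := 1 - ex (-bas i)

/-- `c(l) = 1 - e^l`. -/
noncomputable def c {n : ℕ} (l : ZMod n → ℤ) : RT n := 1 - ex l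

/-- The (level zero) simple root `α_i = a_i - a_{i+1}`; in particular `α_0 = a_n - a_1`. -/
def simpleRoot {n : ℕ} (i : ZMod n) : ZMod n → ℤ := bas i - bas (i + 1)

/-- The action of `u ∈ S_n` on the lattices `X` and `X^∨`: `a_i ↦ a_{u(i)}`, `ε_i ↦ ε_{u(i)}`. -/
def permLattice {n : ℕ} (u : Equiv.Perm (ZMod n)) : (ZMod n → ℤ) ≃+ (ZMod n → ℤ) where
  toFun l := fun i => l (u⁻¹ i)
  invFun l := fun i => l (u i)
  left_inv l := by funext i; simp
  right_inv l := by funext i; simp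
  map_add' _ _ := rfl

/-- The action of `S_n` on `X^∨`, written multiplicatively. -/
def permHom (n : ℕ) : Equiv.Perm (ZMod n) →* MulAut (Multiplicative (ZMod n → ℤ)) where
  toFun u := AddEquiv.toMultiplicative (permLattice u)
  map_one' := rfl
  map_mul' _ _ := rfl

/-- The extended affine Weyl group `X^∨ ⋊ S_n` of `GL_n`. -/
abbrev ExtWeyl (n : ℕ) : Type := Multiplicative (ZMod n → ℤ) ⋊[permHom n] Equiv.Perm (ZMod n)

/-- The translation `t_l`, for `l ∈ X^∨`. -/
def transl {n : ℕ} (l : ZMod n → ℤ) : ExtWeyl n := SemidirectProduct.inl (Multiplicative.ofAdd l)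

/-- The affine simple reflections. For `i ≠ 0`, `s_i` is the transposition of `i` and `i + 1`, and
`s_0 = t_{θ^∨} s_θ`, where `θ^∨ = ε_1 - ε_n` and `s_θ` is the transposition of `1` and `n`. -/
def s {n : ℕ} (i : ZMod n) : ExtWeyl n :=
  (if i = 0 then transl (bas 1 - bas 0) else 1) *
    SemidirectProduct.inr (Equiv.swap i (i + 1))

/-- The rotation `rot = s_1 s_2 ⋯ s_{n-1} ∈ S_n`, that is `i ↦ i + 1` modulo `n`. -/
def rot (n : ℕ) : Equiv.Perm (ZMod n) := Equiv.addRight 1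

/-- The generator `τ = t_{ε_1} s_1 s_2 ⋯ s_{n-1}` of the fundamental group of `GL_n`. -/
def tau (n : ℕ) : ExtWeyl n := transl (bas 1) * SemidirectProduct.inr (rot n)

theorem permLattice_bas {n : ℕ} (u : Equiv.Perm (ZMod n)) (i : ZMod n) :
    permLattice u (bas i) = bas (u i) := by
  funext j
  change (Pi.single i 1 : ZMod n → ℤ) (u⁻¹ j) = (Pi.single (u i) 1 : ZMod n → ℤ) j
  simp only [Pi.single_apply, Equiv.Perm.inv_eq_iff_eq]

theorem transl_mul {n : ℕ} (l l' : ZMod n → ℤ) : transl l * transl l' = transl (l + l') := by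
  unfold transl
  rw [← map_mul]
  rfl

theorem inr_mul_transl {n : ℕ} (u : Equiv.Perm (ZMod n)) (l : ZMod n → ℤ) :
    (SemidirectProduct.inr u : ExtWeyl n) * transl l =
      transl (permLattice u l) * SemidirectProduct.inr u := by
  have h := SemidirectProduct.inl_aut (φ := permHom n) u (Multiplicative.ofAdd l)
  change transl (permLattice u l) = _ at h
  rw [h]
  simp [transl]

theorem s_eq {n : ℕ} (i : ZMod n) :
    s i = transl (if i = 0 then bas 1 - bas 0 else 0) *
      SemidirectProduct.inr (Equiv.swap i (i + 1)) := by
  unfold s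
  split_ifs
  · rfl
  · rfl

theorem s_mul_s {n : ℕ} (i : ZMod n) : s i * s i = 1 := by
  have h : (if i = 0 then bas 1 - bas 0 else 0) + permLattice (Equiv.swap i (i + 1))
      (if i = 0 then bas 1 - bas 0 else 0) = (0 : ZMod n → ℤ) := by
    split_ifs with hi
    · subst hi
      rw [map_sub, permLattice_bas, permLattice_bas, Equiv.swap_apply_left, zero_add,
        Equiv.swap_apply_right]
      abel
    · simp
  rw [s_eq, mul_assoc, ← mul_assoc (SemidirectProduct.inr _) (transl _), inr_mul_transl,
    mul_assoc, ← map_mul, Equiv.swap_mul_self, map_one, mul_one, transl_mul, h]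
  rfl

theorem tau_mul_s {n : ℕ} (i : ZMod n) : tau n * s i = s (i + 1) * tau n := by
  have h1 : rot n * Equiv.swap i (i + 1) = Equiv.swap (i + 1) (i + 1 + 1) * rot n := by
    exact Equiv.mul_swap_eq_swap_mul _ _ _
  have h2 : bas 1 + permLattice (rot n) (if i = 0 then bas 1 - bas 0 else 0) =
      (if i + 1 = 0 then bas 1 - bas 0 else 0) +
        permLattice (Equiv.swap (i + 1) (i + 1 + 1)) (bas 1) := by
    rw [permLattice_bas, Equiv.swap_apply_def, apply_ite (permLattice (rot n)), map_sub, map_zero,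
      permLattice_bas, permLattice_bas]
    change bas 1 + (if i = 0 then bas ((1 : ZMod n) + 1) - bas ((0 : ZMod n) + 1) else 0) = _
    by_cases h0 : i = 0
    · subst h0
      by_cases h1 : (1 : ZMod n) = 0
      · simp [h1]
      · simp [h1]
    · by_cases h1 : i + 1 = 0
      · rw [if_neg h0, if_pos h1, h1]
        have h2 : (1 : ZMod n) ≠ 0 := fun h => h0 (by rw [h, add_zero] at h1; exact h1)
        simp [h2]
      · have h2 : (1 : ZMod n) ≠ i + 1 := fun h => h0 (by simpa using h)
        have h3 : (1 : ZMod n) ≠ i + 1 + 1 := fun h => h1 (by simpa using h)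
        simp only [if_neg h0, if_neg h1, if_neg h2, if_neg h3, add_zero, zero_add]
  rw [s_eq, s_eq, tau, mul_assoc, ← mul_assoc (SemidirectProduct.inr _) (transl _), inr_mul_transl,
    mul_assoc, ← map_mul, h1, ← mul_assoc, transl_mul, h2, mul_assoc,
    ← mul_assoc (SemidirectProduct.inr _) (transl _), inr_mul_transl, mul_assoc, ← map_mul,
    ← mul_assoc, transl_mul]

/-- The affine Weyl group of `SL_n`, generated by `s_0, …, s_{n-1}`. -/
def affWeyl (n : ℕ) : Subgroup (ExtWeyl n) := Subgroup.closure (Set.range s)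

/-- `l` is a reduced word of `w`: a word in the simple reflections with product `w` and
with the smallest possible length. -/
def IsReducedWord {n : ℕ} (l : List (ZMod n)) (w : ExtWeyl n) : Prop :=
  (l.map s).prod = w ∧ ∀ l' : List (ZMod n), (l'.map s).prod = w → l.length ≤ l'.length

theorem exists_isReducedWord {n : ℕ} (w : affWeyl n) : ∃ l, IsReducedWord l w.1 := by
  have h1 : ∃ l : List (ZMod n), (l.map s).prod = w.1 := by
    refine Subgroup.closure_induction (p := fun g _ => ∃ l : List (ZMod n), (l.map s).prod = g)
      ?_ ⟨[], rfl⟩ ?_ ?_ w.2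
    · rintro _ ⟨i, rfl⟩
      exact ⟨[i], by simp⟩
    · rintro _ _ _ _ ⟨l, rfl⟩ ⟨l', rfl⟩
      exact ⟨l ++ l', by simp⟩
    · rintro _ _ ⟨l, rfl⟩
      refine ⟨l.reverse, ?_⟩
      rw [List.prod_inv_reverse, List.map_map, ← List.map_reverse]
      congr 1
      refine List.map_congr_left fun i _ => ?_
      exact eq_inv_of_mul_eq_one_left (s_mul_s i)
  classical
  have h2 : ∃ k, ∃ l : List (ZMod n), (l.map s).prod = w.1 ∧ l.length = k :=
    ⟨_, h1.choose, h1.choose_spec, rfl⟩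
  obtain ⟨l, hl, hk⟩ := Nat.find_spec h2
  exact ⟨l, hl, fun l' hl' => hk ▸ Nat.find_min' h2 ⟨l', hl', rfl⟩⟩

/-! ### The action on symmetric series and the operators `T_i`, `D_i` -/

/-- The action of `u ∈ S_n` on `R(T)`: `e^{a_i} ↦ e^{a_{u(i)}}`, hence `b_i ↦ b_{u(i)}`. -/
noncomputable def permRT {n : ℕ} (u : Equiv.Perm (ZMod n)) : RT n →+* RT n :=
  AddMonoidAlgebra.mapDomainRingHom ℤ (permLattice u)

/-- The action of `u ∈ S_n` on symmetric series: `f(y|b) ↦ f(y|u(b))`. -/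
noncomputable def permSym {n : ℕ} (u : Equiv.Perm (ZMod n)) : SymSeries (RT n) →+* SymSeries (RT n) :=
  symMap (permRT u)

/-- `Ω(b_i|y) = ∏_j (1 - b_i y_j)⁻¹`, an invertible element of `SymSeries (RT n)`. -/
noncomputable def Om {n : ℕ} (i : ZMod n) : (SymSeries (RT n))ˣ := (isUnit_cauchySeries (b i)).unit

/-- The action of `w = t_l u` on symmetric series: `u ∈ S_n` permutes the `b_i` and `t_{ε_i}` is the
multiplication by `Ω(b_i|y)`. -/
noncomputable def weylAct {n : ℕ} [NeZero n] (w : ExtWeyl n) (f : SymSeries (RT n)) : SymSeries (RT n) :=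
  ((∏ i : ZMod n, Om i ^ (w.left.toAdd i) : (SymSeries (RT n))ˣ) : SymSeries (RT n)) * permSym w.right f

theorem ex_add {n : ℕ} (l l' : ZMod n → ℤ) : ex (l + l') = ex l * ex l' := by
  simp [ex, AddMonoidAlgebra.single_mul_single]

theorem ex_zero {n : ℕ} : ex (0 : ZMod n → ℤ) = 1 := rfl

theorem ex_nsmul {n : ℕ} (k : ℕ) (l : ZMod n → ℤ) : ex (k • l) = ex l ^ k := by
  induction k with
  | zero => simp [ex_zero]
  | succ k ih => rw [succ_nsmul, ex_add, ih, pow_succ]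

theorem c_dvd_one_sub_ex_zsmul {n : ℕ} (k : ℤ) (l : ZMod n → ℤ) : c l ∣ 1 - ex (k • l) := by
  have h : ∀ m : ℕ, c l ∣ 1 - ex (m • l) := fun m => by
    rw [ex_nsmul]
    exact one_sub_dvd_one_sub_pow _ _
  obtain ⟨m, rfl | rfl⟩ := Int.eq_nat_or_neg k
  · rw [natCast_zsmul]
    exact h m
  · have : 1 - ex (-(m : ℤ) • l) = -ex (-(m : ℤ) • l) * (1 - ex (m • l)) := by
      rw [mul_sub, mul_one, neg_mul, ← ex_add, neg_smul, natCast_zsmul, neg_add_cancel, ex_zero]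
      ring
    rw [this]
    exact (h m).mul_left _

theorem permRT_ex {n : ℕ} (u : Equiv.Perm (ZMod n)) (l : ZMod n → ℤ) :
    permRT u (ex l) = ex (permLattice u l) :=
  AddMonoidAlgebra.mapDomain_single

theorem permLattice_swap {n : ℕ} (i j : ZMod n) (l : ZMod n → ℤ) :
    permLattice (Equiv.swap i j) l = l + (l j - l i) • (bas i - bas j) := by
  funext k
  change l ((Equiv.swap i j)⁻¹ k) = l k + (l j - l i) * (bas i k - bas j k)
  simp only [bas, Pi.single_apply, Equiv.swap_inv, Equiv.swap_apply_def]
  split_ifs <;> simp_all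

theorem c_dvd_permRT_sub {n : ℕ} (i j : ZMod n) (p : RT n) :
    c (bas i - bas j) ∣ permRT (Equiv.swap i j) p - p := by
  induction p using AddMonoidAlgebra.induction_linear with
  | zero => simp
  | add p q hp hq =>
    have h := dvd_add hp hq
    rwa [← add_sub_add_comm, ← map_add] at h
  | single l r =>
    have h1 : (AddMonoidAlgebra.single l r : RT n) = r • ex l := by
      simp [ex]
    have h2 : permRT (Equiv.swap i j) (ex l) - ex l =
        -ex l * (1 - ex ((l j - l i) • (bas i - bas j))) := by
      rw [permRT_ex, permLattice_swap, ex_add]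
      ring
    rw [h1, map_zsmul, ← smul_sub, h2]
    exact dvd_smul_of_dvd r ((c_dvd_one_sub_ex_zsmul _ _).mul_left _)

theorem exists_divided_difference {n : ℕ} (i j : ZMod n) (f : SymSeries (RT n)) :
    ∃ g : SymSeries (RT n), algebraMap (RT n) (SymSeries (RT n)) (c (bas i - bas j)) * g =
      permSym (Equiv.swap i j) f - f := by
  have h : ∀ p : RT n, ∃ q, c (bas i - bas j) * q = permRT (Equiv.swap i j) p - p := fun p => by
    obtain ⟨q, hq⟩ := c_dvd_permRT_sub i j p
    exact ⟨q, hq.symm⟩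
  choose q hq using h
  refine ⟨⟨fun m => q (MvPowerSeries.coeff m f.1), mem_SymSeries_iff.2 fun σ m => ?_⟩, Subtype.ext ?_⟩
  · change q (MvPowerSeries.coeff (m.mapDomain σ) f.1) = q (MvPowerSeries.coeff m f.1)
    rw [mem_SymSeries_iff.1 f.2 σ m]
  · ext1 m
    change MvPowerSeries.coeff m (MvPowerSeries.C (c (bas i - bas j)) * _) =
      MvPowerSeries.coeff m (MvPowerSeries.map _ f.1 - f.1)
    rw [MvPowerSeries.coeff_C_mul, map_sub, MvPowerSeries.coeff_map]
    exact hq _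

theorem permSym_Om {n : ℕ} (u : Equiv.Perm (ZMod n)) (i : ZMod n) :
    permSym u (Om i : SymSeries (RT n)) = Om (u i) := by
  have hb : permRT u (b i) = b (u i) := by
    rw [b, map_sub, map_one, permRT_ex, map_neg, permLattice_bas, b]
  apply Subtype.ext
  ext1 m
  change permRT u (m.prod fun _ e => b i ^ e) = m.prod fun _ e => b (u i) ^ e
  rw [map_finsuppProd]
  simp only [map_pow, hb]

theorem weylAct_s {n : ℕ} [NeZero n] (i : ZMod n) (f : SymSeries (RT n)) :
    weylAct (s i) f = (if i = 0 then ((Om 1 * (Om 0)⁻¹ : (SymSeries (RT n))ˣ) : SymSeries (RT n)) else 1) *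
      permSym (Equiv.swap i (i + 1)) f := by
  have hl : (s i).left.toAdd = if i = 0 then bas 1 - bas 0 else (0 : ZMod n → ℤ) := by
    rw [s_eq]
    funext j
    change _ + (0 : ℤ) = _
    rw [add_zero]
    rfl
  have hr : (s i).right = Equiv.swap i (i + 1) := by
    rw [s_eq]
    rfl
  unfold weylAct
  rw [hl, hr]
  congr 1
  split_ifs
  · congr 1
    have h : ∀ j : ZMod n, ∏ k, (Om k : (SymSeries (RT n))ˣ) ^ (bas j k) = Om j := fun j => by
      rw [Finset.prod_eq_single j]
      · simp [bas]
      · intro k _ hk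
        simp [bas, hk]
      · simp
    simp only [Pi.sub_apply, zpow_sub, Finset.prod_mul_distrib, Finset.prod_inv_distrib, h]
  · simp

/-- `s_i - 1` is divisible by `c(α_i)` on symmetric series with coefficients in `R(T)`. -/
theorem exists_T {n : ℕ} [NeZero n] (i : ZMod n) (f : SymSeries (RT n)) :
    ∃ g : SymSeries (RT n), algebraMap (RT n) (SymSeries (RT n)) (c (simpleRoot i)) * g =
      weylAct (s i) f - f := by
  by_cases hi : i = 0
  · subst hi
    obtain ⟨g, hg⟩ := exists_divided_difference 0 (0 + 1) (((Om 0 : (SymSeries (RT n))ˣ) : SymSeries (RT n)) * f)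
    refine ⟨(((Om 0)⁻¹ : (SymSeries (RT n))ˣ) : SymSeries (RT n)) * g, ?_⟩
    rw [simpleRoot, mul_left_comm, hg, weylAct_s, if_pos rfl, map_mul, permSym_Om,
      Equiv.swap_apply_left, mul_sub, Units.inv_mul_cancel_left, Units.val_mul, zero_add]
    ring
  · obtain ⟨g, hg⟩ := exists_divided_difference i (i + 1) f
    exact ⟨g, by rw [simpleRoot, hg, weylAct_s, if_neg hi, one_mul]⟩

/-- The quotient in `exists_T` is unique as soon as `n ≥ 2`. -/
theorem T_unique {n : ℕ} (hn : 2 ≤ n) (i : ZMod n) (g g' : SymSeries (RT n))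
    (h : algebraMap (RT n) (SymSeries (RT n)) (c (simpleRoot i)) * g =
      algebraMap (RT n) (SymSeries (RT n)) (c (simpleRoot i)) * g') : g = g' := by
  have : Fact (1 < n) := ⟨hn⟩
  have hne : i + 1 ≠ i := by simp
  have hc : c (simpleRoot i) ≠ 0 := by
    intro h0
    have h1 : (ex (simpleRoot i) : RT n) = ex 0 := (sub_eq_zero.1 h0).symm
    have h2 : simpleRoot i = 0 := by
      by_contra h3
      have h4 := congrArg (fun p : RT n => p.coeff 0) h1
      simp [ex, h3] at h4
    have h3 := congrFun h2 i
    simp [simpleRoot, bas, hne.symm] at h3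
  apply Subtype.ext
  ext1 m
  have h1 := congrArg (fun p : SymSeries (RT n) => MvPowerSeries.coeff m p.1) h
  change MvPowerSeries.coeff m (MvPowerSeries.C (c (simpleRoot i)) * g.1) =
      MvPowerSeries.coeff m (MvPowerSeries.C (c (simpleRoot i)) * g'.1) at h1
  rw [MvPowerSeries.coeff_C_mul, MvPowerSeries.coeff_C_mul] at h1
  exact mul_left_cancel₀ hc h1

/-- `T_i = c(α_i)⁻¹ (s_i - 1)`. -/
noncomputable def T {n : ℕ} [NeZero n] (i : ZMod n) (f : SymSeries (RT n)) : SymSeries (RT n) :=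
  (exists_T i f).choose

theorem T_spec {n : ℕ} [NeZero n] (i : ZMod n) (f : SymSeries (RT n)) :
    algebraMap (RT n) (SymSeries (RT n)) (c (simpleRoot i)) * T i f = weylAct (s i) f - f :=
  (exists_T i f).choose_spec

/-- `D_i = T_i + 1`. -/
noncomputable def D {n : ℕ} [NeZero n] (i : ZMod n) (f : SymSeries (RT n)) : SymSeries (RT n) := T i f + f

/-- `D_w = D_{i_1} ⋯ D_{i_l}` for a reduced word `i_1, …, i_l` of `w` in the affine Weyl group. The
operators `D_i` satisfy the braid relations, so that the choice of the word does not matter. -/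
noncomputable def DW {n : ℕ} [NeZero n] (w : affWeyl n) (f : SymSeries (RT n)) : SymSeries (RT n) :=
  (exists_isReducedWord w).choose.foldr D f

/-- The closed `K`-theoretic double `k`-Schur function of `w`, where `k = n - 1`. -/
noncomputable def gTilde {n : ℕ} [NeZero n] (w : affWeyl n) : SymSeries (RT n) := DW w 1

/-! ### Bounded partitions -/

/-- A `k`-bounded partition: a finite multiset of parts, all between `1` and `k`. -/
@[ext]
structure BoundedPartition (k : ℕ) where
  parts : Multiset ℕ
  pos : ∀ p ∈ parts, 0 < p
  le : ∀ p ∈ parts, p ≤ k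

/-- `lam ∪ mu`: the union of the parts, with multiplicities. -/
def BoundedPartition.union {k : ℕ} (lam mu : BoundedPartition k) : BoundedPartition k where
  parts := lam.parts + mu.parts
  pos p hp := (Multiset.mem_add.1 hp).elim (lam.pos p) (mu.pos p)
  le p hp := (Multiset.mem_add.1 hp).elim (lam.le p) (mu.le p)

/-- The rectangle `R_i = (i)^{n-i}`, with `n - i` rows of length `i`. -/
def rectangle {n : ℕ} (i : ℕ) (hi : 1 ≤ i) (hin : i ≤ n - 1) : BoundedPartition (n - 1) where
  parts := Multiset.replicate (n - i) i
  pos p hp := by rw [Multiset.eq_of_mem_replicate hp]; exact hi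
  le p hp := by rw [Multiset.eq_of_mem_replicate hp]; exact hin

/-- `ρ_p = s_{p-1} s_{p-2} ⋯ s_1 s_0`. -/
def rho (n p : ℕ) : affWeyl n :=
  ((List.range p).reverse.map fun j : ℕ =>
    (⟨s (j : ZMod n), Subgroup.subset_closure ⟨_, rfl⟩⟩ : affWeyl n)).prod

theorem tau_inv_conj_mem {n : ℕ} (w : affWeyl n) : (tau n)⁻¹ * w.1 * tau n ∈ affWeyl n := by
  refine Subgroup.closure_induction
    (p := fun g _ => (tau n)⁻¹ * g * tau n ∈ affWeyl n) ?_ ?_ ?_ ?_ w.2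
  · rintro _ ⟨i, rfl⟩
    have h := tau_mul_s (i - 1)
    rw [sub_add_cancel] at h
    rw [mul_assoc, ← h, inv_mul_cancel_left]
    exact Subgroup.subset_closure ⟨_, rfl⟩
  · simp
  · intro x y _ _ hx hy
    have h := mul_mem hx hy
    have e : (tau n)⁻¹ * x * tau n * ((tau n)⁻¹ * y * tau n) = (tau n)⁻¹ * (x * y) * tau n := by
      group
    rwa [e] at h
  · intro x _ hx
    have h := inv_mem hx
    have e : ((tau n)⁻¹ * x * tau n)⁻¹ = (tau n)⁻¹ * x⁻¹ * tau n := by group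
    rwa [e] at h

/-- The inverse rotation `π_1⁻¹ : s_j ↦ s_{j-1}` of the affine Weyl group, `w ↦ τ⁻¹ w τ`. -/
def piInv {n : ℕ} (w : affWeyl n) : affWeyl n := ⟨(tau n)⁻¹ * w.1 * tau n, tau_inv_conj_mem w⟩

/-- `x_lam = π_1^{-l+1}(ρ_{lam_l}) ⋯ π_1^{-1}(ρ_{lam_2}) ρ_{lam_1}` where
`lam_1 ≥ lam_2 ≥ ⋯ ≥ lam_l` are the parts of `lam`. -/
def xElt {n : ℕ} (lam : BoundedPartition (n - 1)) : affWeyl n :=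
  ((lam.parts.sort (· ≥ ·)).mapIdx fun r p => piInv^[r] (rho n p)).reverse.prod

/-- The closed `K`-theoretic double `k`-Schur function of a `k`-bounded partition, `k = n - 1`. -/
noncomputable def gTildePart {n : ℕ} [NeZero n] (lam : BoundedPartition (n - 1)) : SymSeries (RT n) :=
  gTilde (xElt lam)

end KSchur

namespace KSchur

/-! ### Affine permutations -/

/-! Let the extended affine Weyl group act on `ℤ` by affine permutations, with `τ` as `x ↦ x + 1`,
and put `σ_p = τ ρ_p`, `m = n - i`. Then `x_λ = τ^{-l} σ_{λ_l} ⋯ σ_{λ_1}` (`xElt_eq`). The map `σ_p`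
fixes the residues `1, …, p` and pushes the others along cyclically, so `σ_i^m` is a translation: it
adds `n` to the residues `i+1, …, n`. It commutes with `σ_p` for `p ≥ i`, whence `x_{λ ∪ R_i} =
τ^{-m} x_λ σ_i^m = (τ^{-m} x_λ τ^m) x_{R_i}`. Since `x_λ` is increasing on the window, lengths add
in this factorization (`isReducedWord_map_append`), so the series of `λ ∪ R_i` is `D_{τ^{-m} x_λ
τ^m}` applied to that of `R_i`.

Conjugation by `τ` rotates the indices of the `D_j`. Applying `τ^m` therefore gives `D_{x_λ}(G)`,
where `G` is `τ^m` applied to the series of `R_i`. The key point is that `D_1, …, D_{n-1}` fix `G`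
(`D_weylAct_foldr`). Hence `G` is `S_n`-invariant and multiplication by it commutes with every
`D_j`, including `D_0` (`D_mul_of_invariant`), so `D_{x_λ}(G) = G · D_{x_λ}(1)`. Undoing `τ^m`,
whose permutation part is `ω^m = ω^{-i}`, puts the twist `ω^i` on the factor of `λ`.

As `D_w` is defined through a chosen reduced word, independence of that choice is needed too: the
braid relations of the `D_i` (`D_comm`, `D_braid`) and Matsumoto's theorem
(`foldr_eq_of_isReducedWord`), deduced from the exchange property. -/

theorem cast_eq_iff_exists {n : ℕ} {x y : ℤ} : (x : ZMod n) = y ↔ ∃ k : ℤ, x = y + n * k := by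
  constructor
  · intro h
    obtain ⟨k, hk⟩ := (ZMod.intCast_eq_intCast_iff_dvd_sub y x n).1 h.symm
    exact ⟨k, by linarith⟩
  · rintro ⟨k, rfl⟩
    simp

section AffinePermutations

variable {n : ℕ} [NeZero n]

/-- The representative of a class modulo `n` in the window `{1, …, n}`. -/
def rep (k : ZMod n) : ℤ := ((k - 1).val : ℤ) + 1

theorem rep_cast (k : ZMod n) : ((rep k : ℤ) : ZMod n) = k := by
  simp [rep]

theorem one_le_rep {n : ℕ} (k : ZMod n) : 1 ≤ rep k := by
  unfold rep; omega

theorem rep_le (k : ZMod n) : rep k ≤ n := by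
  have := ZMod.val_lt (k - 1)
  unfold rep; omega

/-- Starting the window at `1` puts the wrap-around at the class `0`, exactly where `s 0` and `tau`
carry their translations. -/
theorem rep_add_one (k : ZMod n) : rep (k + 1) = if k = 0 then 1 else rep k + 1 := by
  unfold rep
  rw [add_sub_cancel_right]
  split_ifs with h
  · simp [h]
  · have h1 : (k - 1 + 1).val = (k - 1).val + 1 := by
      rcases lt_or_ge ((k - 1).val + 1) n with h2 | h2
      · by_cases hn : n = 1
        · omega
        · have : Fact (1 < n) := ⟨by have := NeZero.pos n; omega⟩
          rw [ZMod.val_add_of_lt, ZMod.val_one]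
          rw [ZMod.val_one]; exact h2
      · exfalso
        apply h
        have h3 := ZMod.val_lt (k - 1)
        have h4 : (((k - 1).val + 1 : ℕ) : ZMod n) = 0 := by
          rw [show (k - 1).val + 1 = n by omega]; simp
        push_cast at h4
        rw [ZMod.natCast_zmod_val] at h4
        simpa using h4
    rw [sub_add_cancel] at h1
    rw [h1]; push_cast; ring

theorem rep_zero : rep (0 : ZMod n) = n := by
  unfold rep
  rcases Nat.exists_eq_succ_of_ne_zero (NeZero.ne n) with ⟨m, rfl⟩
  rw [zero_sub, ZMod.val_neg_one]
  push_cast; ring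

/-- The affine permutation of `ℤ` given by an element of the extended affine Weyl group. -/
def affFun (w : ExtWeyl n) (x : ℤ) : ℤ :=
  x - rep (x : ZMod n) + rep (w.right (x : ZMod n)) + n * w.left.toAdd (w.right (x : ZMod n))

theorem affFun_cast (w : ExtWeyl n) (x : ℤ) : ((affFun w x : ℤ) : ZMod n) = w.right x := by
  unfold affFun
  push_cast
  rw [rep_cast, rep_cast]
  simp

theorem affFun_mul (w w' : ExtWeyl n) (x : ℤ) : affFun (w * w') x = affFun w (affFun w' x) := by
  have h : (w * w').left.toAdd ((w * w').right x) =
      w.left.toAdd (w.right (w'.right x)) + w'.left.toAdd (w'.right x) := by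
    change w.left.toAdd (w.right (w'.right x)) +
      w'.left.toAdd (w.right⁻¹ (w.right (w'.right x))) = _
    simp
  rw [affFun, h, affFun, affFun_cast, affFun, SemidirectProduct.mul_right, Equiv.Perm.mul_apply]
  ring

theorem affFun_one {n : ℕ} [NeZero n] (x : ℤ) : affFun (1 : ExtWeyl n) x = x := by
  change x - rep (x : ZMod n) + rep (x : ZMod n) + n * 0 = x
  ring

/-- The action of the extended affine Weyl group on `ℤ` by affine permutations. -/
def aff : ExtWeyl n →* Equiv.Perm ℤ :=
  MonoidHom.toHomPerm
    { toFun := fun w => (affFun w : Function.End ℤ)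
      map_one' := funext affFun_one
      map_mul' := fun w w' => funext (affFun_mul w w') }

theorem aff_apply (w : ExtWeyl n) (x : ℤ) : aff w x = affFun w x := rfl

theorem aff_mul_apply (w w' : ExtWeyl n) (x : ℤ) : aff (w * w') x = aff w (aff w' x) := by
  rw [map_mul, Equiv.Perm.mul_apply]

theorem aff_inv_apply_eq (w : ExtWeyl n) (x y : ℤ) : aff w⁻¹ x = y ↔ x = aff w y := by
  rw [map_inv, Equiv.Perm.inv_eq_iff_eq]

theorem aff_apply_inv_self (w : ExtWeyl n) (x : ℤ) : aff w (aff w⁻¹ x) = x :=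
  ((aff_inv_apply_eq _ _ _).1 rfl).symm

theorem aff_add_mul (w : ExtWeyl n) (x k : ℤ) : aff w (x + n * k) = aff w x + n * k := by
  simp only [aff_apply, affFun]
  push_cast
  simp only [CharP.cast_eq_zero, zero_mul, add_zero]
  ring

theorem aff_add (w : ExtWeyl n) (x : ℤ) : aff w (x + n) = aff w x + n := by
  simpa using aff_add_mul w x 1

theorem exists_window (x : ℤ) : ∃ y k : ℤ, x = y + n * k ∧ 1 ≤ y ∧ y ≤ n := by
  have hn : (0 : ℤ) < n := by exact_mod_cast NeZero.pos n
  refine ⟨(x - 1) % n + 1, (x - 1) / n, ?_, ?_, ?_⟩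
  · have := Int.emod_add_mul_ediv (x - 1) n
    linarith
  · have := Int.emod_nonneg (x - 1) hn.ne'
    linarith
  · have := Int.emod_lt_of_pos (x - 1) hn
    linarith

/-- Faithfulness: identities in `ExtWeyl n` can be checked on integers, and by periodicity on one
window. -/
theorem aff_injective : Function.Injective (aff : ExtWeyl n → Equiv.Perm ℤ) := by
  refine (injective_iff_map_eq_one _).2 fun w hw => ?_
  have h1 : ∀ x : ℤ, affFun w x = x := fun x => by rw [← aff_apply, hw]; rfl
  have hr : ∀ k, w.right k = k := fun k => by
    have := affFun_cast w (rep k)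
    rw [h1, rep_cast] at this
    exact this.symm
  have hl : ∀ k, w.left.toAdd k = 0 := fun k => by
    have := h1 (rep k)
    rw [affFun, rep_cast, hr] at this
    have hn : (n : ℤ) ≠ 0 := by exact_mod_cast NeZero.ne n
    have h2 : (n : ℤ) * w.left.toAdd k = 0 := by linarith
    exact (mul_eq_zero.1 h2).resolve_left hn
  refine SemidirectProduct.ext ?_ (Equiv.ext hr)
  exact congrArg Multiplicative.ofAdd (funext hl)

theorem ext_of_window {w w' : ExtWeyl n}
    (h : ∀ x : ℤ, 1 ≤ x → x ≤ n → aff w x = aff w' x) : w = w' := by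
  refine aff_injective (Equiv.ext fun x => ?_)
  obtain ⟨y, k, rfl, h1, h2⟩ := exists_window (n := n) x
  rw [aff_add_mul, aff_add_mul, h y h1 h2]

theorem aff_tau (x : ℤ) : aff (tau n) x = x + 1 := by
  have hr : (tau n).right = rot n := rfl
  have hl : (tau n).left.toAdd = bas 1 := by
    funext j
    change _ + (0 : ℤ) = _
    rw [add_zero]; rfl
  rw [aff_apply, affFun, hr, hl]
  change x - rep (x : ZMod n) + rep ((x : ZMod n) + 1) + n * bas 1 ((x : ZMod n) + 1) = _
  rw [rep_add_one, bas, Pi.single_apply]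
  simp only [add_eq_right]
  split_ifs with h
  · rw [h, rep_zero]; ring
  · ring

theorem aff_tau_pow (m : ℕ) (x : ℤ) : aff (tau n ^ m) x = x + m := by
  induction m with
  | zero => simp
  | succ m ih => rw [pow_succ', aff_mul_apply, ih, aff_tau]; push_cast; ring

theorem aff_tau_pow_inv (m : ℕ) (x : ℤ) : aff (tau n ^ m)⁻¹ x = x - m := by
  rw [aff_inv_apply_eq, aff_tau_pow]; ring

theorem tau_pow_mul_s {n : ℕ} (m : ℕ) (i : ZMod n) :
    tau n ^ m * s i = s (i + (m : ZMod n)) * tau n ^ m := by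
  induction m with
  | zero => simp
  | succ m ih =>
    rw [pow_succ', mul_assoc, ih, ← mul_assoc, tau_mul_s, mul_assoc]
    push_cast; rw [add_assoc]

variable [Fact (1 < n)]

theorem aff_s (i : ZMod n) (x : ℤ) :
    aff (s i) x = if (x : ZMod n) = i then x + 1 else if (x : ZMod n) = i + 1 then x - 1 else x := by
  have hr : (s i).right = Equiv.swap i (i + 1) := by rw [s_eq]; rfl
  have hl : (s i).left.toAdd = if i = 0 then bas 1 - bas 0 else (0 : ZMod n → ℤ) := by
    rw [s_eq]
    funext j
    change _ + (0 : ℤ) = _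
    rw [add_zero]; rfl
  rw [aff_apply, affFun, hr, hl]
  by_cases h1 : (x : ZMod n) = i
  · rw [if_pos h1, h1, Equiv.swap_apply_left, rep_add_one]
    split_ifs with h
    · subst h; simp [bas, rep_zero]; ring
    · simp; ring
  · rw [if_neg h1]
    by_cases h2 : (x : ZMod n) = i + 1
    · rw [if_pos h2, h2, Equiv.swap_apply_right, rep_add_one]
      split_ifs with h
      · subst h; simp [bas, rep_zero]
      · simp; ring
    · rw [if_neg h2, Equiv.swap_apply_of_ne_of_ne h1 h2]
      split_ifs with h
      · subst h
        rw [zero_add] at h2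
        simp [bas, h1, h2]
      · simp

theorem aff_s_left {i : ZMod n} {x : ℤ} (h : (x : ZMod n) = i) : aff (s i) x = x + 1 := by
  rw [aff_s, if_pos h]

theorem aff_s_right {i : ZMod n} {x : ℤ} (h : (x : ZMod n) = i + 1) : aff (s i) x = x - 1 := by
  rw [aff_s, if_neg (by rw [h]; simp), if_pos h]

theorem aff_s_of_ne {i : ZMod n} {x : ℤ} (h : (x : ZMod n) ≠ i) (h' : (x : ZMod n) ≠ i + 1) :
    aff (s i) x = x := by
  rw [aff_s, if_neg h, if_neg h']

/-- A simple reflection reverses the order of two integers only if it exchanges them. -/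
theorem aff_s_lt {j : ZMod n} {a b : ℤ} (hab : a < b) (h : ¬ ((a : ZMod n) = j ∧ b = a + 1)) :
    aff (s j) a < aff (s j) b := by
  -- A simple reflection moves an integer by at most one, so the order can fail only if `b - a ≤ 2`.
  -- Collisions are excluded by `hne`, and the genuine exchange by `h`.
  have hne : aff (s j) a ≠ aff (s j) b := fun h => hab.ne ((aff (s j)).injective h)
  rw [not_and] at h
  rw [aff_s, aff_s] at hne ⊢
  split_ifs at hne ⊢ <;> first | omega | skip
  all_goals
    have := h (by assumption)
    omega

/-- An affine permutation that maps consecutive integers to consecutive integers conjugates the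
corresponding simple reflections. -/
theorem mul_s_eq_s_mul {g : ExtWeyl n} {i j : ZMod n} {a c : ℤ} (ha : (a : ZMod n) = i)
    (hc : (c : ZMod n) = j) (h1 : aff g a = c) (h2 : aff g (a + 1) = c + 1) :
    g * s i = s j * g := by
  refine aff_injective (Equiv.ext fun x => ?_)
  rw [aff_mul_apply, aff_mul_apply]
  by_cases hx : (x : ZMod n) = i
  · rw [aff_s_left hx]
    obtain ⟨k, rfl⟩ := cast_eq_iff_exists.1 (hx.trans ha.symm)
    rw [show a + n * k + 1 = a + 1 + n * k by ring, aff_add_mul, aff_add_mul, h1, h2,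
      aff_s_left (by push_cast; simp [hc])]
    ring
  by_cases hx' : (x : ZMod n) = i + 1
  · rw [aff_s_right hx']
    have : (x : ZMod n) = ((a + 1 : ℤ) : ZMod n) := by rw [hx']; push_cast; rw [ha]
    obtain ⟨k, rfl⟩ := cast_eq_iff_exists.1 this
    rw [show a + 1 + n * k - 1 = a + n * k by ring, aff_add_mul, aff_add_mul, h1, h2,
      aff_s_right (by push_cast; simp [hc])]
    ring
  have key : ∀ y z : ℤ, aff g y = z → (x : ZMod n) ≠ y → ((aff g x : ℤ) : ZMod n) ≠ z := by
    intro y z hy hne h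
    apply hne
    obtain ⟨k, hk⟩ := cast_eq_iff_exists.1 h
    rw [← hy, ← aff_add_mul] at hk
    rw [(aff g).injective hk]
    simp
  rw [aff_s_of_ne hx hx', aff_s_of_ne]
  · have := key a c h1 (by rwa [ha])
    rwa [hc] at this
  · have := key (a + 1) (c + 1) h2 (by push_cast; rwa [ha])
    push_cast at this
    rwa [hc] at this

end AffinePermutations

/-! ### Reduced words -/

section ReducedWords

variable {n : ℕ} [NeZero n] [Fact (1 < n)]

/-- The product of a word in the simple reflections. -/
def wordProd {n : ℕ} (l : List (ZMod n)) : ExtWeyl n := (l.map s).prod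

theorem wordProd_cons {n : ℕ} (i : ZMod n) (l : List (ZMod n)) :
    wordProd (i :: l) = s i * wordProd l := by
  simp [wordProd]

theorem wordProd_append {n : ℕ} (l l' : List (ZMod n)) :
    wordProd (l ++ l') = wordProd l * wordProd l' := by
  simp [wordProd]

theorem s_mul_cancel {n : ℕ} (i : ZMod n) (w : ExtWeyl n) : s i * (s i * w) = w := by
  rw [← mul_assoc, s_mul_s, one_mul]

theorem s_inv {n : ℕ} (i : ZMod n) : (s i)⁻¹ = s i := inv_eq_of_mul_eq_one_left (s_mul_s i)

/-- The exchange property. -/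
theorem exchange (l : List (ZMod n)) (g : ExtWeyl n) (i : ZMod n) (a : ℤ) (ha : (a : ZMod n) = i)
    (hlt : aff g a < aff g (a + 1))
    (h : aff (wordProd l)⁻¹ (aff g (a + 1)) < aff (wordProd l)⁻¹ (aff g a)) :
    ∃ l' : List (ZMod n), wordProd l' = g * s i * g⁻¹ * wordProd l ∧ l'.length + 1 = l.length := by
  induction l generalizing g with
  | nil =>
    simp only [wordProd, List.map_nil, List.prod_nil, inv_one, map_one, Equiv.Perm.one_apply] at h
    exact absurd h hlt.asymm
  | cons j m ih =>
    -- Follow the pair `g a < g (a + 1)` through the letters. If the first letter exchanges the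
    -- pair, it equals `g s_i g⁻¹` and cancels. Otherwise it keeps the order, and the tail is
    -- applied to the moved pair.
    by_cases hj : ((aff g a : ℤ) : ZMod n) = j ∧ aff g (a + 1) = aff g a + 1
    · refine ⟨m, ?_, rfl⟩
      rw [mul_s_eq_s_mul ha hj.1 rfl hj.2, wordProd_cons, mul_inv_cancel_right, s_mul_cancel]
    · have hlt' := aff_s_lt hlt hj
      rw [← aff_mul_apply, ← aff_mul_apply] at hlt'
      obtain ⟨m', hm, hlen⟩ := ih (s j * g) hlt' (by
        rw [wordProd_cons, mul_inv_rev, s_inv] at h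
        rwa [aff_mul_apply, aff_mul_apply, ← aff_mul_apply _ (s j), ← aff_mul_apply _ (s j)])
      refine ⟨j :: m', ?_, by simp [hlen]⟩
      rw [wordProd_cons, hm, wordProd_cons, mul_inv_rev, s_inv]
      simp only [mul_assoc]
      rw [s_mul_cancel]

/-- `w` has the left descent `a` (a class modulo `n`). -/
def LeftDescent (w : ExtWeyl n) (a : ℤ) : Prop := aff w⁻¹ (a + 1) < aff w⁻¹ a

theorem leftDescent_s_mul (w : ExtWeyl n) (a : ℤ) :
    LeftDescent (s (a : ZMod n) * w) a ↔ ¬ LeftDescent w a := by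
  have h1 : aff (s (a : ZMod n)) a = a + 1 := aff_s_left rfl
  have h2 : aff (s (a : ZMod n)) (a + 1) = a := by
    rw [aff_s_right (by push_cast; rfl)]; ring
  have hne : aff w⁻¹ a ≠ aff w⁻¹ (a + 1) := fun h => by
    have := (aff w⁻¹).injective h
    omega
  rw [LeftDescent, LeftDescent, mul_inv_rev, s_inv, aff_mul_apply, aff_mul_apply, h1, h2]
  omega

theorem exists_word_of_leftDescent {l : List (ZMod n)} {a : ℤ}
    (h : LeftDescent (wordProd l) a) :
    ∃ l', wordProd l' = s (a : ZMod n) * wordProd l ∧ l'.length + 1 = l.length := by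
  obtain ⟨l', h1, h2⟩ := exchange l 1 a a rfl (by simp) (by
    rw [map_one]; exact h)
  exact ⟨l', by simpa using h1, h2⟩

theorem IsReducedWord.tail {n : ℕ} {i : ZMod n} {l : List (ZMod n)} {w : ExtWeyl n}
    (h : IsReducedWord (i :: l) w) : IsReducedWord l (s i * w) := by
  have hw : wordProd (i :: l) = w := h.1
  rw [wordProd_cons] at hw
  refine ⟨by rw [← hw, s_mul_cancel]; rfl, fun l' hl' => ?_⟩
  have := h.2 (i :: l') (by
    change wordProd _ = _
    rw [wordProd_cons, show wordProd l' = s i * w from hl', s_mul_cancel])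
  simpa using this

/-- Since `a` is a left descent of `s_a w`, any word for `s_a w` loses a letter by exchange and
becomes a word for `w`, so it is longer than `l`. -/
theorem IsReducedWord.cons {a : ℤ} {l : List (ZMod n)} {w : ExtWeyl n}
    (h : IsReducedWord l w) (hd : ¬ LeftDescent w a) :
    IsReducedWord ((a : ZMod n) :: l) (s (a : ZMod n) * w) := by
  have hw : wordProd l = w := h.1
  refine ⟨show wordProd _ = _ by rw [wordProd_cons, hw], fun l' hl' => ?_⟩
  replace hl' : wordProd l' = s (a : ZMod n) * w := hl'
  rw [← leftDescent_s_mul, ← hl'] at hd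
  obtain ⟨m, hm, hlen⟩ := exists_word_of_leftDescent hd
  have := h.2 m (show wordProd m = w by rw [hm, hl', s_mul_cancel])
  simp only [List.length_cons]
  omega

theorem IsReducedWord.leftDescent {a : ℤ} {l : List (ZMod n)} {w : ExtWeyl n}
    (h : IsReducedWord ((a : ZMod n) :: l) w) : LeftDescent w a := by
  by_contra hd
  have hw : wordProd ((a : ZMod n) :: l) = w := h.1
  rw [wordProd_cons] at hw
  rw [← hw, leftDescent_s_mul, not_not] at hd
  obtain ⟨m, hm, hlen⟩ := exists_word_of_leftDescent hd
  have := h.2 m (hm.trans hw)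
  simp only [List.length_cons] at this
  omega

theorem IsReducedWord.of_length_le {n : ℕ} {l l' : List (ZMod n)} {w : ExtWeyl n}
    (h : IsReducedWord l w) (h' : wordProd l' = w) (hlen : l'.length ≤ l.length) :
    IsReducedWord l' w :=
  ⟨h', fun m hm => hlen.trans (h.2 m hm)⟩

theorem IsReducedWord.length_eq {n : ℕ} {l l' : List (ZMod n)} {w : ExtWeyl n}
    (h : IsReducedWord l w) (h' : IsReducedWord l' w) : l.length = l'.length :=
  le_antisymm (h.2 _ h'.1) (h'.2 _ h.1)

theorem exists_isReducedWord_cons {a : ℤ} {l : List (ZMod n)} {w : ExtWeyl n}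
    (h : IsReducedWord l w) (hd : LeftDescent w a) :
    ∃ l', IsReducedWord ((a : ZMod n) :: l') w := by
  have hw : wordProd l = w := h.1
  rw [← hw] at hd
  obtain ⟨m, hm, hlen⟩ := exists_word_of_leftDescent hd
  exact ⟨m, h.of_length_le (by rw [wordProd_cons, hm, s_mul_cancel, hw]) (by simp [hlen])⟩

theorem s_mul_comm {i j : ZMod n} (h1 : i ≠ j) (h2 : j ≠ i + 1) (h3 : i ≠ j + 1) :
    s i * s j = s j * s i := by
  obtain ⟨a, rfl⟩ := ZMod.intCast_surjective j
  have h4 : ((a + 1 : ℤ) : ZMod n) ≠ i := by push_cast; exact h3.symm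
  have h5 : ((a + 1 : ℤ) : ZMod n) ≠ i + 1 := by push_cast; simpa using h1.symm
  exact mul_s_eq_s_mul rfl rfl (aff_s_of_ne h1.symm h2) (aff_s_of_ne h4 h5)

theorem two_ne_zero_zmod {n : ℕ} (hn : 2 < n) : (1 + 1 : ZMod n) ≠ 0 := by
  intro h
  have : ((2 : ℕ) : ZMod n) = 0 := by push_cast; rw [← h]; ring
  rw [ZMod.natCast_eq_zero_iff] at this
  exact absurd (Nat.le_of_dvd (by norm_num) this) (by omega)

theorem s_braid (hn : 2 < n) (i : ZMod n) :
    s i * s (i + 1) * s i = s (i + 1) * s i * s (i + 1) := by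
  obtain ⟨a, rfl⟩ := ZMod.intCast_surjective i
  have h2 := two_ne_zero_zmod hn
  have key : s (a : ZMod n) * s ((a : ZMod n) + 1) * s (a : ZMod n) =
      s ((a + 1 : ℤ) : ZMod n) * (s (a : ZMod n) * s ((a : ZMod n) + 1)) := by
    refine mul_s_eq_s_mul (a := a) (c := a + 1) rfl rfl ?_ ?_
    · have h : aff (s ((a : ZMod n) + 1)) a = a :=
        aff_s_of_ne (by simp) (by simpa [add_assoc] using h2)
      rw [aff_mul_apply, h, aff_s_left rfl]
    · have h : aff (s ((a : ZMod n) + 1)) (a + 1) = a + 1 + 1 := aff_s_left (by push_cast; rfl)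
      rw [aff_mul_apply, h, aff_s_of_ne]
      · push_cast; simpa [add_assoc] using h2
      · push_cast; simp
  rw [key, mul_assoc]
  push_cast; rfl

/-- A form of the theorem of Matsumoto: operators satisfying the braid relations can be composed
along reduced words, independently of the choice of the reduced word. -/
theorem foldr_eq_of_isReducedWord {M : Type*} (E : ZMod n → M → M)
    (hcomm : ∀ i j, i ≠ j → j ≠ i + 1 → i ≠ j + 1 → ∀ f, E i (E j f) = E j (E i f))
    (hbraid : 2 < n → ∀ i f, E i (E (i + 1) (E i f)) = E (i + 1) (E i (E (i + 1) f)))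
    {l l' : List (ZMod n)} {w : ExtWeyl n} (hl : IsReducedWord l w) (hl' : IsReducedWord l' w)
    (f : M) : l.foldr E f = l'.foldr E f := by
  induction hk : l.length using Nat.strong_induction_on generalizing l l' w with
  | h k ih =>
  have hlen := hl.length_eq hl'
  have side : ∀ (a : ℤ) {m m' : List (ZMod n)}, m.length + 1 = k →
      IsReducedWord ((a : ZMod n) :: m) w →
      IsReducedWord (((a + 1 : ℤ) : ZMod n) :: m') w →
      (((a : ZMod n)) :: m).foldr E f = ((((a + 1 : ℤ) : ZMod n)) :: m').foldr E f := by
    intro a m m' hm h1 h2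
    have hlm := h1.length_eq h2
    have d1 : aff w⁻¹ (a + 1) < aff w⁻¹ a := h1.leftDescent
    have d2 : aff w⁻¹ (a + 1 + 1) < aff w⁻¹ (a + 1) := h2.leftDescent
    -- For `n = 2` the two descents would give `w⁻¹ a + 2 < w⁻¹ a`.
    have hn : 2 < n := by
      by_contra hn
      have h3 : n = 2 := by have := Fact.out (p := 1 < n); omega
      have h4 : aff w⁻¹ (a + 1 + 1) = aff w⁻¹ a + n := by
        rw [← aff_add]; congr 1; omega
      omega
    have h20 := two_ne_zero_zmod hn
    have e1 : aff (s (a : ZMod n)) a = a + 1 := aff_s_left rfl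
    have e2 : aff (s (a : ZMod n)) (a + 1) = a := by
      rw [aff_s_right (by push_cast; rfl)]; ring
    have e3 : aff (s (a : ZMod n)) (a + 1 + 1) = a + 1 + 1 := by
      apply aff_s_of_ne
      · push_cast; simpa [add_assoc] using h20
      · push_cast; simp
    have e4 : aff (s ((a + 1 : ℤ) : ZMod n)) a = a := by
      apply aff_s_of_ne
      · push_cast; simp
      · push_cast; simpa [add_assoc] using h20
    have e5 : aff (s ((a + 1 : ℤ) : ZMod n)) (a + 1) = a + 1 + 1 := aff_s_left rfl
    -- Descents at both `a` and `a + 1` allow splitting off a full braid `s_a s_{a+1} s_a` from `w`,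
    -- leaving `q`. Below, `hq'` reads the same element with the braid started at `a + 1`.
    obtain ⟨p, hp⟩ := exists_isReducedWord_cons (a := a + 1) h1.tail (by
      rw [LeftDescent, mul_inv_rev, s_inv, aff_mul_apply, aff_mul_apply, e2, e3]
      exact d2.trans d1)
    obtain ⟨q, hq⟩ := exists_isReducedWord_cons (a := a) hp.tail (by
      rw [LeftDescent, mul_inv_rev, mul_inv_rev, s_inv, s_inv, aff_mul_apply, aff_mul_apply,
        aff_mul_apply, aff_mul_apply, e4, e5, e1, e3]
      exact d2)
    have hlp := h1.tail.length_eq hp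
    have hlq := hp.tail.length_eq hq
    simp only [List.length_cons] at hlp hlq hlm
    have hq' : IsReducedWord (((a : ℤ) : ZMod n) :: ((a + 1 : ℤ) : ZMod n) :: q)
        (s ((a + 1 : ℤ) : ZMod n) * w) := by
      refine h2.tail.of_length_le ?_ (by simp; omega)
      have e : s (a : ZMod n) * (s ((a + 1 : ℤ) : ZMod n) * (s (a : ZMod n) * w)) =
          wordProd q := hq.tail.1.symm
      rw [wordProd_cons, wordProd_cons, ← e]
      have hb := s_braid hn (a : ZMod n)
      push_cast at hb ⊢
      have : s ((a : ZMod n) + 1) * (s (a : ZMod n) * (s ((a : ZMod n) + 1) * (s (a : ZMod n) * w)))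
          = s (a : ZMod n) * (s ((a : ZMod n) + 1) * (s (a : ZMod n) * (s (a : ZMod n) * w))) := by
        simp only [← mul_assoc]
        rw [← hb]
      rw [this, s_mul_cancel, s_mul_cancel]
    have f1 := ih m.length (by omega) h1.tail hp rfl
    have f2 := ih p.length (by omega) hp.tail hq rfl
    have f3 := ih m'.length (by omega) h2.tail hq' rfl
    simp only [List.foldr_cons] at f1 f2 f3 ⊢
    rw [f1, f2, f3]
    have hb := hbraid hn (a : ZMod n) (q.foldr E f)
    push_cast at hb ⊢
    exact hb
  match l, l' with
  | [], [] => rfl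
  | [], _ :: _ => simp at hlen
  | _ :: _, [] => simp at hlen
  | i :: m, j :: m' =>
    simp only [List.length_cons] at hlen hk
    by_cases hij : i = j
    · subst hij
      rw [List.foldr_cons, List.foldr_cons, ih m.length (by omega) hl.tail hl'.tail rfl]
    obtain ⟨a, rfl⟩ := ZMod.intCast_surjective i
    by_cases h1 : j = (a : ZMod n) + 1
    · have hj : j = ((a + 1 : ℤ) : ZMod n) := by rw [h1]; push_cast; rfl
      subst hj
      exact side a (by omega) hl hl'
    obtain ⟨c, rfl⟩ := ZMod.intCast_surjective j
    by_cases h2 : (a : ZMod n) = (c : ZMod n) + 1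
    · have hj : (a : ZMod n) = ((c + 1 : ℤ) : ZMod n) := by rw [h2]; push_cast; rfl
      rw [hj] at hl ⊢
      exact (side c (by omega) hl' hl).symm
    have h3 : ((c + 1 : ℤ) : ZMod n) ≠ (a : ZMod n) := by push_cast; exact Ne.symm h2
    have h4 : ((c + 1 : ℤ) : ZMod n) ≠ (a : ZMod n) + 1 := by
      push_cast; simpa using Ne.symm hij
    obtain ⟨p, hp⟩ := exists_isReducedWord_cons (a := c) hl.tail (by
      rw [LeftDescent, mul_inv_rev, s_inv, aff_mul_apply, aff_mul_apply,
        aff_s_of_ne h3 h4, aff_s_of_ne (Ne.symm hij) h1]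
      exact hl'.leftDescent)
    have hlp := hl.tail.length_eq hp
    simp only [List.length_cons] at hlp
    have hq : IsReducedWord ((a : ZMod n) :: p) (s (c : ZMod n) * w) := by
      refine hl'.tail.of_length_le ?_ (by simp; omega)
      have e : s (c : ZMod n) * (s (a : ZMod n) * w) = wordProd p := hp.tail.1.symm
      rw [wordProd_cons, ← e, ← mul_assoc, s_mul_comm hij h1 h2, mul_assoc, s_mul_cancel]
    have f1 := ih m.length (by omega) hl.tail hp rfl
    have f2 := ih m'.length (by omega) hl'.tail hq rfl
    rw [List.foldr_cons, List.foldr_cons, f1, f2]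
    exact hcomm _ _ hij h1 h2 _

end ReducedWords

/-! ### The action on symmetric series -/

section Operators

variable {n : ℕ} [NeZero n]

theorem permRT_mul {n : ℕ} (u v : Equiv.Perm (ZMod n)) (p : RT n) :
    permRT (u * v) p = permRT u (permRT v p) := by
  induction p using AddMonoidAlgebra.induction_linear with
  | zero => simp
  | add p q hp hq => rw [map_add, map_add, map_add, hp, hq]
  | single l r =>
    simp only [permRT, AddMonoidAlgebra.mapDomainRingHom_apply, AddMonoidAlgebra.mapDomain_single]
    rfl

theorem permRT_one {n : ℕ} (p : RT n) : permRT 1 p = p := by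
  induction p using AddMonoidAlgebra.induction_linear with
  | zero => simp
  | add p q hp hq => rw [map_add, hp, hq]
  | single l r => exact AddMonoidAlgebra.mapDomain_single

theorem permSym_mul {n : ℕ} (u v : Equiv.Perm (ZMod n)) (f : SymSeries (RT n)) :
    permSym (u * v) f = permSym u (permSym v f) := by
  apply Subtype.ext
  ext1 m
  exact permRT_mul u v _

theorem permSym_one {n : ℕ} (f : SymSeries (RT n)) : permSym 1 f = f := by
  apply Subtype.ext
  ext1 m
  exact permRT_one _

/-- The multiplication operator of a translation. -/
noncomputable def OmProd (l : ZMod n → ℤ) : (SymSeries (RT n))ˣ := ∏ i : ZMod n, Om i ^ l i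

theorem OmProd_add (l l' : ZMod n → ℤ) : OmProd (l + l') = OmProd l * OmProd l' := by
  simp only [OmProd, Pi.add_apply, zpow_add, Finset.prod_mul_distrib]

theorem OmProd_zero : OmProd (0 : ZMod n → ℤ) = 1 := by
  simp [OmProd]

theorem permSym_OmProd (u : Equiv.Perm (ZMod n)) (l : ZMod n → ℤ) :
    permSym u (OmProd l : SymSeries (RT n)) = OmProd (permLattice u l) := by
  have h : Units.map (permSym u : SymSeries (RT n) →* SymSeries (RT n)) (OmProd l) =
      OmProd (permLattice u l) := by
    have h1 : ∀ i, Units.map (permSym u : SymSeries (RT n) →* SymSeries (RT n)) (Om i) =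
        Om (u i) := fun i => Units.ext (permSym_Om u i)
    rw [OmProd, map_prod, OmProd, ← Equiv.prod_comp u (fun i => Om i ^ permLattice u l i)]
    refine Finset.prod_congr rfl fun i _ => ?_
    rw [map_zpow, h1]
    congr 1
    change l i = l (u⁻¹ (u i))
    simp
  exact congrArg Units.val h

theorem weylAct_eq (w : ExtWeyl n) (f : SymSeries (RT n)) :
    weylAct w f = (OmProd w.left.toAdd : SymSeries (RT n)) * permSym w.right f := rfl

/-- This rests on `u t_l u⁻¹ = t_{u l}`, matched on series by `permSym_OmProd`. -/
theorem weylAct_mul (w w' : ExtWeyl n) (f : SymSeries (RT n)) :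
    weylAct (w * w') f = weylAct w (weylAct w' f) := by
  rw [weylAct_eq, weylAct_eq, weylAct_eq, map_mul, permSym_OmProd, SemidirectProduct.mul_right,
    permSym_mul, ← mul_assoc, ← Units.val_mul, ← OmProd_add]
  rfl

theorem weylAct_one (f : SymSeries (RT n)) : weylAct 1 f = f := by
  have hl : (1 : ExtWeyl n).left.toAdd = 0 := rfl
  have hr : (1 : ExtWeyl n).right = 1 := rfl
  rw [weylAct_eq, hl, hr, permSym_one, OmProd_zero, Units.val_one, one_mul]

theorem weylAct_sub (w : ExtWeyl n) (f g : SymSeries (RT n)) :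
    weylAct w (f - g) = weylAct w f - weylAct w g := by
  rw [weylAct_eq, map_sub, mul_sub]; rfl

/-- The translation factor is used once only, so one factor sees `w` and the other merely its
permutation part. -/
theorem weylAct_mul_right (w : ExtWeyl n) (f g : SymSeries (RT n)) :
    weylAct w (f * g) = permSym w.right f * weylAct w g := by
  rw [weylAct_eq, map_mul, mul_left_comm]; rfl

theorem weylAct_mul_left (w : ExtWeyl n) (f g : SymSeries (RT n)) :
    weylAct w (f * g) = weylAct w f * permSym w.right g := by
  rw [weylAct_eq, map_mul, ← mul_assoc]; rfl

theorem weylAct_injective (w : ExtWeyl n) : Function.Injective (weylAct w) := by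
  intro f g h
  rw [← weylAct_one f, ← weylAct_one g, ← inv_mul_cancel w, weylAct_mul, weylAct_mul, h]

/-- The exponential `e^l` as a constant symmetric series. -/
noncomputable def exS {n : ℕ} (l : ZMod n → ℤ) : SymSeries (RT n) := algebraMap _ _ (ex l)

theorem exS_add {n : ℕ} (l l' : ZMod n → ℤ) : exS (l + l') = exS l * exS l' := by
  rw [exS, ex_add, map_mul]; rfl

theorem exS_neg_mul {n : ℕ} (l : ZMod n → ℤ) : exS (-l) * exS l = 1 := by
  rw [← exS_add, neg_add_cancel, exS, ex_zero, map_one]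

theorem permSym_exS {n : ℕ} (u : Equiv.Perm (ZMod n)) (l : ZMod n → ℤ) :
    permSym u (exS l) = exS (permLattice u l) := by
  apply Subtype.ext
  change MvPowerSeries.map (permRT u) (MvPowerSeries.C (ex l)) = MvPowerSeries.C _
  rw [MvPowerSeries.map_C, permRT_ex]

theorem algebraMap_c {n : ℕ} (l : ZMod n → ℤ) :
    algebraMap (RT n) (SymSeries (RT n)) (c l) = 1 - exS l := by
  rw [c, map_sub, map_one]; rfl

theorem s_right {n : ℕ} (i : ZMod n) : (s i).right = Equiv.swap i (i + 1) := by
  rw [s_eq]; rfl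

/-! ### Relations between the operators `D_i`. -/

theorem D_spec (i : ZMod n) (f : SymSeries (RT n)) :
    (1 - exS (simpleRoot i)) * D i f = weylAct (s i) f - exS (simpleRoot i) * f := by
  have h := T_spec i f
  rw [algebraMap_c] at h
  rw [D, mul_add, h]
  ring

/-- Identities between the `D_i` can be checked after clearing denominators, coefficient by
coefficient in the domain `R(T)`. Non-simple roots are allowed because the braid relation needs one.
-/
theorem one_sub_exS_cancel {n : ℕ} {i j : ZMod n} (hij : i ≠ j) {g g' : SymSeries (RT n)}
    (h : (1 - exS (bas i - bas j)) * g = (1 - exS (bas i - bas j)) * g') : g = g' := by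
  have hc : c (bas i - bas j) ≠ 0 := by
    intro h0
    have h1 : (ex (bas i - bas j) : RT n) = ex 0 := (sub_eq_zero.1 h0).symm
    have h2 : bas i - bas j = 0 := by
      by_contra h3
      have h4 := congrArg (fun p : RT n => p.coeff 0) h1
      simp [ex, h3] at h4
    have h3 := congrFun h2 i
    simp [bas, hij] at h3
  rw [← algebraMap_c] at h
  apply Subtype.ext
  ext1 m
  have h1 := congrArg (fun p : SymSeries (RT n) => MvPowerSeries.coeff m p.1) h
  change MvPowerSeries.coeff m (MvPowerSeries.C (c (bas i - bas j)) * g.1) =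
      MvPowerSeries.coeff m (MvPowerSeries.C (c (bas i - bas j)) * g'.1) at h1
  rw [MvPowerSeries.coeff_C_mul, MvPowerSeries.coeff_C_mul] at h1
  exact mul_left_cancel₀ hc h1

theorem weylAct_exS_mul (w : ExtWeyl n) (l : ZMod n → ℤ) (f : SymSeries (RT n)) :
    weylAct w (exS l * f) = exS (permLattice w.right l) * weylAct w f := by
  rw [weylAct_mul_right, permSym_exS]

theorem weylAct_one_sub_exS_mul (w : ExtWeyl n) (l : ZMod n → ℤ) (f : SymSeries (RT n)) :
    weylAct w ((1 - exS l) * f) = (1 - exS (permLattice w.right l)) * weylAct w f := by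
  rw [weylAct_mul_right, map_sub, map_one, permSym_exS]

theorem weylAct_s_s (i : ZMod n) (f : SymSeries (RT n)) :
    weylAct (s i) (weylAct (s i) f) = f := by
  rw [← weylAct_mul, s_mul_s, weylAct_one]

theorem permLattice_s_simpleRoot {n : ℕ} (i : ZMod n) :
    permLattice (s i).right (simpleRoot i) = -simpleRoot i := by
  rw [s_right, simpleRoot, map_sub, permLattice_bas, permLattice_bas, Equiv.swap_apply_left,
    Equiv.swap_apply_right]
  abel

theorem D_cancel {n : ℕ} [Fact (1 < n)] (i : ZMod n) {g g' : SymSeries (RT n)}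
    (h : (1 - exS (simpleRoot i)) * g = (1 - exS (simpleRoot i)) * g') : g = g' :=
  one_sub_exS_cancel (by simp) h

theorem rot_pow_self {n : ℕ} : rot n ^ n = 1 := by
  ext k
  have : ∀ m : ℕ, (rot n ^ m) k = k + m := by
    intro m
    induction m with
    | zero => simp
    | succ m ih =>
      rw [pow_succ', Equiv.Perm.mul_apply, ih]
      change k + m + 1 = _
      push_cast; ring
  rw [this]; simp

theorem weylAct_s_comm_spec {i j : ZMod n}
    (hp : permLattice (s i).right (simpleRoot j) = simpleRoot j) (f : SymSeries (RT n)) :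
    (1 - exS (simpleRoot j)) * ((1 - exS (simpleRoot i)) * D i (D j f)) =
      weylAct (s i) (weylAct (s j) f) - exS (simpleRoot j) * weylAct (s i) f -
        exS (simpleRoot i) * weylAct (s j) f + exS (simpleRoot i) * exS (simpleRoot j) * f := by
  have h1 := D_spec i (D j f)
  have h2 := D_spec j f
  have h3 := congrArg (weylAct (s i)) h2
  rw [weylAct_one_sub_exS_mul, weylAct_sub, weylAct_exS_mul, hp] at h3
  linear_combination (1 - exS (simpleRoot j)) * h1 + h3 - exS (simpleRoot i) * h2

variable [Fact (1 < n)]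

theorem D_eq_of_spec {i : ZMod n} {f g : SymSeries (RT n)}
    (h : (1 - exS (simpleRoot i)) * g = weylAct (s i) f - exS (simpleRoot i) * f) : D i f = g :=
  D_cancel i ((D_spec i f).trans h.symm)

/-- The reflection exchanges `f` with `s_i f` and negates `α_i`; the quotient `(s_i f - e^{α_i} f) /
(1 - e^{α_i})` is unchanged by this. -/
theorem weylAct_s_D (i : ZMod n) (f : SymSeries (RT n)) : weylAct (s i) (D i f) = D i f := by
  have h := congrArg (weylAct (s i)) (D_spec i f)
  rw [weylAct_one_sub_exS_mul, weylAct_sub, weylAct_exS_mul, weylAct_s_s,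
    permLattice_s_simpleRoot] at h
  have h1 := exS_neg_mul (simpleRoot i)
  have h2 := D_spec i f
  apply D_cancel i
  linear_combination -exS (simpleRoot i) * h - h2 +
    (weylAct (s i) f - weylAct (s i) (D i f)) * h1

theorem D_eq_self_iff (i : ZMod n) (f : SymSeries (RT n)) : D i f = f ↔ weylAct (s i) f = f := by
  constructor
  · intro h
    rw [← h, weylAct_s_D]
  · intro h
    apply D_eq_of_spec
    rw [h]; ring

theorem D_idem (i : ZMod n) (f : SymSeries (RT n)) : D i (D i f) = D i f :=
  (D_eq_self_iff _ _).2 (weylAct_s_D i f)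

theorem D_comm {i j : ZMod n} (h1 : i ≠ j) (h2 : j ≠ i + 1) (h3 : i ≠ j + 1)
    (f : SymSeries (RT n)) : D i (D j f) = D j (D i f) := by
  have fix : ∀ {i j : ZMod n}, i ≠ j → j ≠ i + 1 → i ≠ j + 1 →
      permLattice (s i).right (simpleRoot j) = simpleRoot j := by
    intro i j h1 h2 h3
    rw [s_right, simpleRoot, map_sub, permLattice_bas, permLattice_bas,
      Equiv.swap_apply_of_ne_of_ne h1.symm h2,
      Equiv.swap_apply_of_ne_of_ne h3.symm (by simpa using h1.symm)]
  have e1 := weylAct_s_comm_spec (fix h1 h2 h3) f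
  have e2 := weylAct_s_comm_spec (fix h1.symm h3 h2) f
  have e3 : weylAct (s i) (weylAct (s j) f) = weylAct (s j) (weylAct (s i) f) := by
    rw [← weylAct_mul, ← weylAct_mul, s_mul_comm h1 h2 h3]
  apply D_cancel i
  apply D_cancel j
  linear_combination e1 - e2 + e3

/-- With the three positive roots of the rank two system cleared, the expansion is symmetric in `i`
and `j` except for its longest term, where `s_braid` takes over. -/
theorem D_braid_spec {i j k l : ZMod n}
    (hsum : simpleRoot i + simpleRoot j = bas k - bas l)
    (hi : permLattice (s i).right (simpleRoot j) = simpleRoot i + simpleRoot j)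
    (hj : permLattice (s j).right (simpleRoot i) = simpleRoot i + simpleRoot j)
    (f : SymSeries (RT n)) :
    (1 - exS (simpleRoot i)) * ((1 - exS (simpleRoot j)) * ((1 - exS (bas k - bas l)) *
        D i (D j (D i f)))) =
      weylAct (s i) (weylAct (s j) (weylAct (s i) f))
        - exS (simpleRoot j) * weylAct (s i) (weylAct (s j) f)
        - exS (simpleRoot i) * weylAct (s j) (weylAct (s i) f)
        + exS (simpleRoot i) ^ 2 * exS (simpleRoot j) * weylAct (s j) f
        + exS (simpleRoot i) * exS (simpleRoot j) ^ 2 * weylAct (s i) f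
        - exS (simpleRoot i) ^ 2 * exS (simpleRoot j) ^ 2 * f := by
  have hi' : permLattice (s i).right (simpleRoot i + simpleRoot j) = simpleRoot j := by
    rw [map_add, permLattice_s_simpleRoot, hi]; abel
  rw [← hsum, exS_add]
  have hX := D_spec i f
  have huX := congrArg (weylAct (s j)) hX
  rw [weylAct_one_sub_exS_mul, weylAct_sub, weylAct_exS_mul, hj] at huX
  have hsuX := congrArg (weylAct (s i)) huX
  rw [weylAct_one_sub_exS_mul, weylAct_sub, weylAct_exS_mul, hi'] at hsuX
  have hY := D_spec j (D i f)
  have hsY := congrArg (weylAct (s i)) hY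
  rw [weylAct_one_sub_exS_mul, weylAct_sub, weylAct_exS_mul, hi, weylAct_s_D] at hsY
  have hZ := D_spec i (D j (D i f))
  rw [exS_add] at huX hsY
  set a := exS (simpleRoot i)
  set b := exS (simpleRoot j)
  -- Expanding the two outer `D_i` produces the denominator `1 - a` twice, and one of them divides
  -- the numerator; hence the extra factor here.
  apply D_cancel i
  change (1 - a) * _ = (1 - a) * _
  linear_combination (1 - a) * (1 - b) * (1 - a * b) * hZ + (1 - a) * (1 - b) * hsY
    + (1 - a) * hsuX - a * b * (1 - b) * hX - a * (1 - a) * (1 - a * b) * hY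
    - a * (1 - a) * huX + a * b * (1 - a * b) * hX

theorem D_braid (hn : 2 < n) (i : ZMod n) (f : SymSeries (RT n)) :
    D i (D (i + 1) (D i f)) = D (i + 1) (D i (D (i + 1) f)) := by
  have h2 := two_ne_zero_zmod hn
  have hkl : i ≠ i + 1 + 1 := by simpa [add_assoc] using h2
  have hsum : simpleRoot i + simpleRoot (i + 1) = bas i - bas (i + 1 + 1) := by
    simp only [simpleRoot]; abel
  have hi : permLattice (s i).right (simpleRoot (i + 1)) =
      simpleRoot i + simpleRoot (i + 1) := by
    rw [hsum, s_right, simpleRoot, map_sub, permLattice_bas, permLattice_bas,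
      Equiv.swap_apply_right, Equiv.swap_apply_of_ne_of_ne hkl.symm (by simp)]
  have hj : permLattice (s (i + 1)).right (simpleRoot i) =
      simpleRoot i + simpleRoot (i + 1) := by
    rw [hsum, s_right, simpleRoot, map_sub, permLattice_bas, permLattice_bas,
      Equiv.swap_apply_left, Equiv.swap_apply_of_ne_of_ne (by simp) hkl]
  have e1 := D_braid_spec hsum hi hj f
  rw [add_comm (simpleRoot i)] at hsum hi hj
  have e2 := D_braid_spec hsum hj hi f
  have e3 : weylAct (s i) (weylAct (s (i + 1)) (weylAct (s i) f)) =
      weylAct (s (i + 1)) (weylAct (s i) (weylAct (s (i + 1)) f)) := by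
    simp only [← weylAct_mul, ← mul_assoc]
    rw [s_braid hn]
  apply one_sub_exS_cancel hkl
  apply D_cancel (i + 1)
  apply D_cancel i
  linear_combination e1 - e2 + e3

/-! ### Independence of the reduced word, rotation by `τ`, and invariant factors. -/

theorem foldr_D_eq {l l' : List (ZMod n)} {w : ExtWeyl n} (hl : IsReducedWord l w)
    (hl' : IsReducedWord l' w) (f : SymSeries (RT n)) : l.foldr D f = l'.foldr D f :=
  foldr_eq_of_isReducedWord D (fun _ _ h1 h2 h3 => D_comm h1 h2 h3) D_braid hl hl' f

theorem gTilde_eq {l : List (ZMod n)} {w : affWeyl n} (hl : IsReducedWord l w.1) :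
    gTilde w = l.foldr D 1 :=
  foldr_D_eq (exists_isReducedWord w).choose_spec hl 1

/-- `D_a` fixes `D_w f` when `a` is a left descent of `w`. -/
theorem D_foldr_of_leftDescent {a : ℤ} {l : List (ZMod n)} {w : ExtWeyl n}
    (hl : IsReducedWord l w) (hd : LeftDescent w a) (f : SymSeries (RT n)) :
    D (a : ZMod n) (l.foldr D f) = l.foldr D f := by
  obtain ⟨m, hm⟩ := exists_isReducedWord_cons hl hd
  rw [foldr_D_eq hl hm, List.foldr_cons, D_idem]

theorem tau_right {n : ℕ} : (tau n).right = rot n := rfl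

theorem permLattice_rot_simpleRoot {n : ℕ} (i : ZMod n) :
    permLattice (rot n) (simpleRoot i) = simpleRoot (i + 1) := by
  rw [simpleRoot, map_sub, permLattice_bas, permLattice_bas]; rfl

theorem weylAct_tau_D (i : ZMod n) (f : SymSeries (RT n)) :
    weylAct (tau n) (D i f) = D (i + 1) (weylAct (tau n) f) := by
  symm
  apply D_eq_of_spec
  have h := congrArg (weylAct (tau n)) (D_spec i f)
  rw [weylAct_one_sub_exS_mul, weylAct_sub, weylAct_exS_mul, tau_right,
    permLattice_rot_simpleRoot, ← weylAct_mul, tau_mul_s, weylAct_mul] at h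
  exact h

theorem weylAct_tau_pow_D (m : ℕ) (i : ZMod n) (f : SymSeries (RT n)) :
    weylAct (tau n ^ m) (D i f) = D (i + (m : ZMod n)) (weylAct (tau n ^ m) f) := by
  induction m with
  | zero => simp [weylAct_one]
  | succ m ih =>
    rw [pow_succ', weylAct_mul, ih, weylAct_tau_D, weylAct_mul, Nat.cast_succ, add_assoc]

theorem weylAct_tau_pow_foldr (m : ℕ) (l : List (ZMod n)) (f : SymSeries (RT n)) :
    weylAct (tau n ^ m) ((l.map fun i => i - (m : ZMod n)).foldr D f) =
      l.foldr D (weylAct (tau n ^ m) f) := by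
  induction l with
  | nil => rfl
  | cons i l ih =>
    rw [List.map_cons, List.foldr_cons, List.foldr_cons, weylAct_tau_pow_D, ih, sub_add_cancel]

theorem tau_pow_right {n : ℕ} (m : ℕ) : (tau n ^ m).right = rot n ^ m :=
  map_pow (SemidirectProduct.rightHom : ExtWeyl n →* Equiv.Perm (ZMod n)) (tau n) m

/-- An element fixed by `D_j` for `j ≠ 0` is invariant under the finite Weyl group. -/
theorem permSym_swap_eq_self {G : SymSeries (RT n)}
    (h : ∀ a : ℤ, 1 ≤ a → a < n → D (a : ZMod n) G = G) (i : ZMod n) :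
    permSym (Equiv.swap i (i + 1)) G = G := by
  have h0 : ∀ i : ZMod n, i ≠ 0 → permSym (Equiv.swap i (i + 1)) G = G := by
    intro i hi
    have h1 : D i G = G := by
      have hlt : rep i < n := by
        refine lt_of_le_of_ne (rep_le i) fun h => hi ?_
        rw [← rep_cast i, h]; simp
      have := h (rep i) (one_le_rep i) hlt
      rwa [rep_cast] at this
    rwa [D_eq_self_iff, weylAct_s, if_neg hi, one_mul] at h1
  by_cases hi : i = 0
  · subst hi
    -- Only the transposition of `1` and `n` is left. No hypothesis on `D 0` is available, so it is
    -- built by conjugating `(1, m+1)` with `(m+1, m+2)` up to `m + 1 = n`.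
    have key : ∀ m : ℕ, 1 ≤ m → m < n →
        permSym (Equiv.swap 1 ((m : ZMod n) + 1)) G = G := by
      intro m hm hmn
      have hm0 : (m : ZMod n) ≠ 0 := by
        rw [Ne, ZMod.natCast_eq_zero_iff]
        exact fun h => absurd (Nat.le_of_dvd (by omega) h) (by omega)
      induction m, hm using Nat.le_induction with
      | base => simpa using h0 1 one_ne_zero
      | succ m hm ih =>
        have hm0' : (m : ZMod n) ≠ 0 := by
          rw [Ne, ZMod.natCast_eq_zero_iff]
          exact fun h => absurd (Nat.le_of_dvd (by omega) h) (by omega)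
        have ih := ih (by omega) hm0'
        have h1 := h0 _ hm0
        push_cast at h1 hm0 ⊢
        have e : Equiv.swap (1 : ZMod n) ((m : ZMod n) + 1 + 1) =
            Equiv.swap ((m : ZMod n) + 1) (m + 1 + 1) * Equiv.swap 1 ((m : ZMod n) + 1) *
              Equiv.swap ((m : ZMod n) + 1) (m + 1 + 1) := by
          have h2 : (1 : ZMod n) ≠ m + 1 := by simpa using hm0'
          have h3 : (1 : ZMod n) ≠ m + 1 + 1 := fun h => hm0 (by simpa using h)
          rw [Equiv.swap_mul_swap_mul_swap h2 h3, Equiv.swap_comm]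
        rw [e, permSym_mul, permSym_mul, h1, ih, h1]
    have hn1 : 1 < n := Fact.out
    have := key (n - 1) (by omega) (by omega)
    rw [Nat.cast_sub hn1.le, CharP.cast_eq_zero, Nat.cast_one, sub_add_cancel,
      Equiv.swap_comm] at this
    rwa [zero_add]
  · exact h0 i hi

/-- This includes `i = 0`: the translation part of `s_0` is itself a multiplication, so only the
permutation part has to fix `G`. -/
theorem D_mul_of_invariant {G : SymSeries (RT n)}
    (h : ∀ i : ZMod n, permSym (Equiv.swap i (i + 1)) G = G) (i : ZMod n) (f : SymSeries (RT n)) :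
    D i (G * f) = G * D i f := by
  apply D_eq_of_spec
  have := D_spec i f
  rw [weylAct_mul_right, s_right, h]
  linear_combination G * this

theorem foldr_D_mul_of_invariant {G : SymSeries (RT n)}
    (h : ∀ i : ZMod n, permSym (Equiv.swap i (i + 1)) G = G) (l : List (ZMod n))
    (f : SymSeries (RT n)) : l.foldr D (G * f) = G * l.foldr D f := by
  induction l with
  | nil => rfl
  | cons i l ih => rw [List.foldr_cons, List.foldr_cons, ih, D_mul_of_invariant h]

end Operators

/-! ### The elements `x_lam` and the rectangles -/

section Rectangles

variable {n : ℕ} [NeZero n] [Fact (1 < n)]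

theorem intCast_ne_of_lt {n : ℕ} {x y : ℤ} (h1 : x < y) (h2 : y < x + n) :
    (x : ZMod n) ≠ (y : ZMod n) := by
  intro h
  have h3 := (ZMod.intCast_eq_intCast_iff_dvd_sub x y n).1 h
  have := Int.le_of_dvd (by omega) h3
  omega

theorem rho_succ (n p : ℕ) : (rho n (p + 1)).1 = s (p : ZMod n) * (rho n p).1 := by
  simp [rho, List.range_succ]

theorem aff_rho {p : ℕ} (hp : p < n) (x : ℤ) (h1 : 1 ≤ x) (hx : x ≤ n) :
    aff (rho n p).1 x = if x ≤ p then x - 1 else if x < n then x else x + p := by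
  induction p with
  | zero =>
    have h : (rho n 0).1 = 1 := rfl
    rw [h, map_one, Equiv.Perm.one_apply]
    split_ifs <;> push_cast at * <;> omega
  | succ p ih =>
    rw [rho_succ, aff_mul_apply, ih (by omega)]
    have hcast : ((p : ℕ) : ZMod n) = ((p : ℤ) : ZMod n) := by push_cast; rfl
    have hcast' : ((p : ℕ) : ZMod n) + 1 = ((p + 1 : ℤ) : ZMod n) := by push_cast; rfl
    by_cases hxp : x ≤ p
    · rw [if_pos hxp, if_pos (by push_cast; omega), aff_s_of_ne]
      · rw [hcast]; exact intCast_ne_of_lt (by omega) (by omega)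
      · rw [hcast']; exact intCast_ne_of_lt (by omega) (by omega)
    rw [if_neg hxp]
    by_cases hxp' : x = p + 1
    · rw [if_pos (by omega), if_pos (by push_cast; omega), aff_s_right (by rw [hcast', hxp'])]
    by_cases hxn : x < n
    · rw [if_pos hxn, if_neg (by push_cast; omega), if_pos hxn, aff_s_of_ne]
      · rw [hcast]; exact (intCast_ne_of_lt (by omega) (by omega)).symm
      · rw [hcast']; exact (intCast_ne_of_lt (by omega) (by omega)).symm
    · have hxn' : x = n := by omega
      subst hxn'
      rw [if_neg (by omega), if_neg (by push_cast; omega), if_neg (by omega),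
        aff_s_left (by push_cast; simp)]
      push_cast; ring

/-- `σ_p = τ ρ_p`. -/
def sigma (n p : ℕ) : ExtWeyl n := tau n * (rho n p).1

/-- Off the fixed residues `1, …, p`, the map goes to the next integer that is not of such a
residue; the jump `p + 1` at `n` skips a block of fixed ones. -/
theorem aff_sigma {p : ℕ} (hp : p < n) (x : ℤ) (h1 : 1 ≤ x) (hx : x ≤ n) :
    aff (sigma n p) x = if x ≤ p then x else if x < n then x + 1 else x + p + 1 := by
  rw [sigma, aff_mul_apply, aff_tau, aff_rho hp x h1 hx]
  split_ifs <;> ring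

/-- `σ_{p_l} ⋯ σ_{p_1}` for a list `p_1, …, p_l`. -/
def sigmaProd (n : ℕ) (L : List ℕ) : ExtWeyl n := (L.reverse.map (sigma n)).prod

theorem sigmaProd_append {n : ℕ} (L L' : List ℕ) :
    sigmaProd n (L ++ L') = sigmaProd n L' * sigmaProd n L := by
  simp [sigmaProd]

theorem sigmaProd_singleton {n : ℕ} (p : ℕ) : sigmaProd n [p] = sigma n p := by
  simp [sigmaProd]

theorem sigmaProd_replicate {n : ℕ} (m p : ℕ) :
    sigmaProd n (List.replicate m p) = sigma n p ^ m := by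
  simp [sigmaProd]

theorem piInv_iterate {n : ℕ} (r : ℕ) (w : affWeyl n) :
    (piInv^[r] w).1 = (tau n ^ r)⁻¹ * w.1 * tau n ^ r := by
  induction r with
  | zero => simp
  | succ r ih =>
    rw [Function.iterate_succ_apply']
    change (tau n)⁻¹ * (piInv^[r] w).1 * tau n = _
    rw [ih, pow_succ]
    group

/-- `π_1^{-r}` is conjugation by `τ^r`, so the powers of `τ` telescope: one goes into each `ρ_p` to
form `σ_p`, and the rest collect on the left. -/
theorem mapIdx_rho_prod {n : ℕ} (L : List ℕ) :
    ((L.mapIdx fun r p => piInv^[r] (rho n p)).reverse.prod : affWeyl n).1 =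
      (tau n ^ L.length)⁻¹ * sigmaProd n L := by
  induction L using List.reverseRecOn with
  | nil => simp [sigmaProd]
  | append_singleton L p ih =>
    rw [List.mapIdx_append, List.reverse_append, List.prod_append, Subgroup.coe_mul, ih,
      sigmaProd_append, sigmaProd_singleton]
    simp only [List.mapIdx_cons, List.mapIdx_nil, List.reverse_cons, List.reverse_nil,
      List.nil_append, List.prod_singleton, zero_add, piInv_iterate, List.length_append,
      List.length_singleton, sigma, pow_succ']
    group

theorem xElt_eq {n : ℕ} (lam : BoundedPartition (n - 1)) :
    (xElt lam).1 = (tau n ^ lam.parts.card)⁻¹ * sigmaProd n (lam.parts.sort (· ≥ ·)) := by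
  rw [xElt, mapIdx_rho_prod, Multiset.length_sort]

/-- `w` is increasing on the window `{1, …, n}`: it has minimal length in its coset. -/
def IsGrassmannian (w : ExtWeyl n) : Prop :=
  ∀ x y : ℤ, 1 ≤ x → x < y → y ≤ n → aff w x < aff w y

theorem le_aff_sigma {p : ℕ} (hp : p < n) (x : ℤ) : x ≤ aff (sigma n p) x := by
  obtain ⟨x, k, rfl, h1, h2⟩ := exists_window (n := n) x
  rw [aff_add_mul, aff_sigma hp x h1 h2]
  split_ifs <;> omega

theorem aff_sigma_lt {p : ℕ} (hp : p < n) {x y : ℤ} (hxy : x < y)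
    (hcx : ∀ z : ℤ, 1 ≤ z → z ≤ p → (x : ZMod n) ≠ (z : ZMod n))
    (hcy : ∀ z : ℤ, 1 ≤ z → z ≤ p → (y : ZMod n) ≠ (z : ZMod n)) :
    aff (sigma n p) x < aff (sigma n p) y := by
  obtain ⟨x, k, rfl, h1, h2⟩ := exists_window (n := n) x
  obtain ⟨y, l, rfl, h3, h4⟩ := exists_window (n := n) y
  have hx' : ¬ x ≤ p := fun h => hcx x h1 h (by simp)
  have hy' : ¬ y ≤ p := fun h => hcy y h3 h (by simp)
  rw [aff_add_mul, aff_add_mul, aff_sigma hp x h1 h2, aff_sigma hp y h3 h4, if_neg hx', if_neg hy']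
  have hkl : k ≤ l := by
    by_contra! h
    have : (n : ℤ) * (l + 1) ≤ n * k := mul_le_mul_of_nonneg_left (by omega) (by omega)
    rw [mul_add, mul_one] at this
    omega
  rcases hkl.eq_or_lt with rfl | hkl
  · split_ifs <;> omega
  · have : (n : ℤ) * (k + 1) ≤ n * l := mul_le_mul_of_nonneg_left (by omega) (by omega)
    rw [mul_add, mul_one] at this
    split_ifs <;> omega

/-- The second clause drives the induction. A new smallest part `p` meets a product fixing `1, …,
p`, so the rest of the window avoids these residues, where `σ_p` is an increasing successor map. For
a fixed `x` it suffices that `σ_p` lowers nothing. -/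
theorem sigmaProd_window (L : List ℕ) (hL : L.Pairwise (· ≥ ·)) (hn : ∀ p ∈ L, p < n) :
    IsGrassmannian (sigmaProd n L) ∧
      ∀ q : ℕ, q < n → (∀ p ∈ L, q ≤ p) → ∀ x : ℤ, 1 ≤ x → x ≤ q → aff (sigmaProd n L) x = x := by
  induction L using List.reverseRecOn with
  | nil => exact ⟨fun x y _ h _ => by simpa [sigmaProd] using h, by simp [sigmaProd]⟩
  | append_singleton L p ih =>
    rw [List.pairwise_append] at hL
    obtain ⟨h1, h2⟩ := ih hL.1 fun q hq => hn q (by simp [hq])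
    have hp : p < n := hn p (by simp)
    have hpL : ∀ q ∈ L, p ≤ q := fun q hq => hL.2.2 q hq p (by simp)
    have hfix := h2 p hp hpL
    have hclass : ∀ x z : ℤ, 1 ≤ x → x ≤ n → p < x → 1 ≤ z → z ≤ p →
        ((aff (sigmaProd n L) x : ℤ) : ZMod n) ≠ (z : ZMod n) := by
      intro x z hx1 hxn hx hz1 hzp h
      obtain ⟨k, hk⟩ := cast_eq_iff_exists.1 h
      rw [← hfix z hz1 hzp, ← aff_add_mul] at hk
      have h3 := (aff (sigmaProd n L)).injective hk
      exact (intCast_ne_of_lt (n := n) (x := z) (y := x) (by omega) (by omega)) (by rw [h3]; simp)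
    refine ⟨fun x y hx hxy hy => ?_, fun q hq hqL x hx hxq => ?_⟩
    · rw [sigmaProd_append, sigmaProd_singleton, aff_mul_apply, aff_mul_apply]
      by_cases hxp : x ≤ p
      · have hx' : aff (sigma n p) x = x := by rw [aff_sigma hp x hx (by omega), if_pos hxp]
        have := h1 x y hx hxy hy
        rw [hfix x hx hxp] at this ⊢
        rw [hx']
        exact this.trans_le (le_aff_sigma hp _)
      · exact aff_sigma_lt hp (h1 x y hx hxy hy)
          (fun z => hclass x z hx (by omega) (by omega))
          (fun z => hclass y z (by omega) hy (by omega))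
    · have hqp : q ≤ p := hqL p (by simp)
      rw [sigmaProd_append, sigmaProd_singleton, aff_mul_apply, hfix x hx (by omega),
        aff_sigma hp x hx (by omega), if_pos (by omega)]

/-! ### Rectangles as translations. -/

theorem aff_sigma_pow {p m : ℕ} (hp : p < n) (x : ℤ) (h1 : 1 ≤ x) (hx : x ≤ n) (hm : p + m ≤ n) :
    aff (sigma n p ^ m) x = if x ≤ p then x else if x + m ≤ n then x + m else x + m + p := by
  induction m with
  | zero =>
    rw [pow_zero, map_one, Equiv.Perm.one_apply]
    push_cast
    split_ifs <;> omega
  | succ m ih =>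
    rw [pow_succ', aff_mul_apply, ih (by omega)]
    push_cast
    by_cases hxp : x ≤ p
    · rw [if_pos hxp, if_pos hxp, aff_sigma hp x h1 hx, if_pos hxp]
    rw [if_neg hxp, if_neg hxp]
    by_cases hxm : x + m ≤ n
    · rw [if_pos hxm, aff_sigma hp _ (by omega) hxm, if_neg (by omega)]
      split_ifs <;> omega
    · rw [if_neg hxm, if_neg (by omega), show x + m + p = x + m + p - n + n by ring, aff_add,
        aff_sigma hp _ (by omega) (by omega), if_neg (by omega), if_pos (by omega)]
      ring

/-- The translation by `n` of the residues `i + 1, …, n`. -/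
theorem aff_sigma_pow_sub {i : ℕ} (hi : i < n) (x : ℤ) (h1 : 1 ≤ x) (hx : x ≤ n) :
    aff (sigma n i ^ (n - i)) x = if x ≤ i then x else x + n := by
  rw [aff_sigma_pow hi x h1 hx (by omega), Nat.cast_sub hi.le]
  split_ifs <;> omega

theorem aff_sigma_pow_sub_inv {i : ℕ} (hi : i < n) (x : ℤ) (h1 : 1 ≤ x) (hx : x ≤ n) :
    aff (sigma n i ^ (n - i))⁻¹ x = if x ≤ i then x else x - n := by
  rw [aff_inv_apply_eq]
  split_ifs with h
  · rw [aff_sigma_pow_sub hi x h1 hx, if_pos h]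
  · rw [show x - (n : ℤ) = x + n * (-1) by ring, aff_add_mul, aff_sigma_pow_sub hi x h1 hx, if_neg h]
    ring

/-- For `i ≤ p`, `σ_p` preserves the set of residues above `i`, on which `σ_i^{n-i}` adds `n`. -/
theorem sigma_commute {i p : ℕ} (hip : i ≤ p) (hp : p < n) :
    Commute (sigma n i ^ (n - i)) (sigma n p) := by
  have hi : i < n := by omega
  refine ext_of_window fun x h1 hx => ?_
  rw [aff_mul_apply, aff_mul_apply, aff_sigma hp x h1 hx, aff_sigma_pow_sub hi x h1 hx]
  by_cases h2 : x ≤ i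
  · rw [if_pos (by omega), if_pos h2, aff_sigma_pow_sub hi x h1 hx, if_pos h2,
      aff_sigma hp x h1 hx, if_pos (by omega)]
  rw [if_neg h2, aff_add, aff_sigma hp x h1 hx]
  by_cases h3 : x ≤ p
  · rw [if_pos h3, aff_sigma_pow_sub hi x h1 hx, if_neg h2]
  rw [if_neg h3]
  by_cases h4 : x < n
  · rw [if_pos h4, aff_sigma_pow_sub hi _ (by omega) (by omega), if_neg (by omega)]
  · rw [if_neg h4, show x + p + 1 = p + 1 + n by omega, aff_add,
      aff_sigma_pow_sub hi _ (by omega) (by omega), if_neg (by omega)]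

theorem sigmaProd_commute {i : ℕ} (L : List ℕ) (hL : ∀ p ∈ L, i ≤ p ∧ p < n) :
    Commute (sigma n i ^ (n - i)) (sigmaProd n L) := by
  refine Commute.list_prod_right _ _ fun w hw => ?_
  obtain ⟨p, hp, rfl⟩ := List.mem_map.1 hw
  obtain ⟨h1, h2⟩ := hL p (List.mem_reverse.1 hp)
  exact sigma_commute h1 h2

theorem sort_eq_of_pairwise {M : Multiset ℕ} {L : List ℕ} (h : (L : Multiset ℕ) = M)
    (hL : L.Pairwise (· ≥ ·)) : M.sort (· ≥ ·) = L := by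
  have hp : (M.sort (· ≥ ·)).Perm L := by
    rw [← Multiset.coe_eq_coe, Multiset.sort_eq, h]
  exact hp.eq_of_pairwise (fun a b _ _ h1 h2 => le_antisymm h2 h1) (Multiset.pairwise_sort _ _) hL

/-- In decreasing order only the factors of the parts `≥ i` stand to the right of the rectangle, and
these commute with it. -/
theorem sigmaProd_sort_add_replicate {i : ℕ} (M : Multiset ℕ) (hM : ∀ p ∈ M, p < n) :
    sigmaProd n ((M + Multiset.replicate (n - i) i).sort (· ≥ ·)) =
      sigmaProd n (M.sort (· ≥ ·)) * sigma n i ^ (n - i) := by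
  have hbig : ∀ p ∈ (M.filter (i ≤ ·)).sort (· ≥ ·), p ∈ M ∧ i ≤ p := fun p hp => by
    simpa using hp
  have hsmall : ∀ p ∈ (M.filter (¬ i ≤ ·)).sort (· ≥ ·), p ∈ M ∧ p < i := fun p hp => by
    simpa using hp
  have sb := Multiset.pairwise_sort (M.filter (i ≤ ·)) (· ≥ ·)
  have ss := Multiset.pairwise_sort (M.filter (¬ i ≤ ·)) (· ≥ ·)
  have e1 := sort_eq_of_pairwise (M := M)
    (L := (M.filter (i ≤ ·)).sort (· ≥ ·) ++ (M.filter (¬ i ≤ ·)).sort (· ≥ ·))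
    (by rw [← Multiset.coe_add, Multiset.sort_eq, Multiset.sort_eq, Multiset.filter_add_not])
    (List.pairwise_append.2 ⟨sb, ss, fun a ha b hb => by
      have := hbig a ha; have := hsmall b hb; omega⟩)
  have e2 := sort_eq_of_pairwise (M := M + Multiset.replicate (n - i) i)
    (L := (M.filter (i ≤ ·)).sort (· ≥ ·) ++ List.replicate (n - i) i ++
      (M.filter (¬ i ≤ ·)).sort (· ≥ ·))
    (by
      rw [← Multiset.coe_add, ← Multiset.coe_add, Multiset.sort_eq, Multiset.sort_eq,
        Multiset.coe_replicate, add_right_comm, Multiset.filter_add_not])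
    (List.pairwise_append.2 ⟨List.pairwise_append.2 ⟨sb, by simp [List.pairwise_replicate],
      fun a ha b hb => by
        have := hbig a ha; have := List.eq_of_mem_replicate hb; omega⟩, ss, fun a ha b hb => by
      have := hsmall b hb
      rcases List.mem_append.1 ha with ha | ha
      · have := hbig a ha; omega
      · have := List.eq_of_mem_replicate ha; omega⟩)
  rw [e1, e2, sigmaProd_append, sigmaProd_append, sigmaProd_append, sigmaProd_replicate, mul_assoc,
    (sigmaProd_commute _ fun p hp => ⟨(hbig p hp).2, hM p (hbig p hp).1⟩).eq]

/-- An order could break only between window positions with values congruent to `a` and `a + 1` and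
adjacent; `w⁻¹` would then increase there, against the descent. -/
theorem IsGrassmannian.s_mul {a : ℤ} {w : ExtWeyl n} (h : IsGrassmannian w)
    (hd : LeftDescent w a) : IsGrassmannian (s (a : ZMod n) * w) := by
  intro x y hx hxy hy
  rw [aff_mul_apply, aff_mul_apply]
  refine aff_s_lt (h x y hx hxy hy) ?_
  rintro ⟨h1, h2⟩
  obtain ⟨k, hk⟩ := cast_eq_iff_exists.1 h1
  have e1 : aff w⁻¹ a = x + n * (-k) := by
    rw [aff_inv_apply_eq, aff_add_mul, hk]; ring
  have e2 : aff w⁻¹ (a + 1) = y + n * (-k) := by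
    rw [aff_inv_apply_eq, aff_add_mul, h2, hk]; ring
  rw [LeftDescent, e1, e2] at hd
  omega

/-- Reduced words of Grassmannian elements remain reduced after multiplication by an antidominant
translation, up to a rotation. -/
theorem isReducedWord_map_append {i m : ℕ} (hi : i < n) {l l' : List (ZMod n)} {w : ExtWeyl n}
    (hw : IsGrassmannian w) (hl : IsReducedWord l w)
    (hl' : IsReducedWord l' ((tau n ^ m)⁻¹ * sigma n i ^ (n - i))) :
    IsReducedWord ((l.map fun j => j - (m : ZMod n)) ++ l')
      ((tau n ^ m)⁻¹ * w * sigma n i ^ (n - i)) := by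
  induction l generalizing w with
  | nil =>
    have : w = 1 := hl.1.symm
    subst this
    simpa using hl'
  | cons j l ih =>
    obtain ⟨a, rfl⟩ := ZMod.intCast_surjective j
    have hd := hl.leftDescent
    have hv := hw.s_mul hd
    have h := ih hv hl.tail
    set v := s (a : ZMod n) * w with hvdef
    have hwv : w = s (a : ZMod n) * v := by rw [hvdef, s_mul_cancel]
    have hdv : ¬ LeftDescent v a := by
      rw [hvdef, leftDescent_s_mul, not_not]; exact hd
    have hnd : ¬ LeftDescent ((tau n ^ m)⁻¹ * v * sigma n i ^ (n - i)) (a - m) := by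
      have hlt : aff v⁻¹ a < aff v⁻¹ (a + 1) := by
        refine lt_of_le_of_ne (not_lt.1 hdv) fun h => ?_
        have := (aff v⁻¹).injective h
        omega
      rw [LeftDescent, mul_inv_rev, mul_inv_rev, inv_inv, aff_mul_apply, aff_mul_apply,
        aff_mul_apply, aff_mul_apply, aff_tau_pow, aff_tau_pow, not_lt,
        show a - (m : ℤ) + 1 + m = a + 1 by ring, sub_add_cancel]
      obtain ⟨x, k, hxk, hx1, hx2⟩ := exists_window (n := n) (aff v⁻¹ a)
      obtain ⟨y, k', hyk, hy1, hy2⟩ := exists_window (n := n) (aff v⁻¹ (a + 1))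
      rw [hxk, hyk] at hlt ⊢
      rw [aff_add_mul, aff_add_mul, aff_sigma_pow_sub_inv hi x hx1 hx2,
        aff_sigma_pow_sub_inv hi y hy1 hy2]
      have hkk : k ≤ k' := by
        by_contra! h
        have : (n : ℤ) * (k' + 1) ≤ n * k := mul_le_mul_of_nonneg_left (by omega) (by omega)
        rw [mul_add, mul_one] at this
        omega
      -- Preimages in one window are impossible, as `w = s_a v` would reverse them. In different
      -- windows the translation lowers `y` past `x` at worst by `n`, and when it lowers `y` but not
      -- `x` one has `x ≤ i < y`, so the order survives.
      rcases hkk.eq_or_lt with rfl | hkk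
      · exfalso
        have e1 : aff w (x + n * k) = a + 1 := by
          rw [hwv, aff_mul_apply, ← hxk, aff_apply_inv_self, aff_s_left rfl]
        have e2 : aff w (y + n * k) = a := by
          rw [hwv, aff_mul_apply, ← hyk, aff_apply_inv_self,
            aff_s_right (by push_cast; rfl)]
          ring
        have := hw x y hx1 (by omega) hy2
        rw [aff_add_mul] at e1 e2
        omega
      · have : (n : ℤ) * (k + 1) ≤ n * k' := mul_le_mul_of_nonneg_left (by omega) (by omega)
        rw [mul_add, mul_one] at this
        split_ifs <;> omega
    have h1 := h.cons hnd
    have hcast : (((a - m : ℤ)) : ZMod n) = (a : ZMod n) - (m : ZMod n) := by push_cast; rfl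
    rw [hcast] at h1
    rw [List.map_cons, List.cons_append, hwv]
    convert h1 using 1
    have ht := tau_pow_mul_s m ((a : ZMod n) - (m : ZMod n))
    rw [sub_add_cancel] at ht
    have ht' : (tau n ^ m)⁻¹ * s (a : ZMod n) =
        s ((a : ZMod n) - (m : ZMod n)) * (tau n ^ m)⁻¹ := by
      rw [inv_mul_eq_iff_eq_mul, ← mul_assoc, ht, mul_inv_cancel_right]
    simp only [← mul_assoc]
    rw [ht']

theorem IsGrassmannian.tau_pow_inv_mul {n : ℕ} [NeZero n] {m : ℕ} {w : ExtWeyl n} (h : IsGrassmannian w) :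
    IsGrassmannian ((tau n ^ m)⁻¹ * w) := by
  intro x y hx hxy hy
  rw [aff_mul_apply, aff_mul_apply, aff_tau_pow_inv, aff_tau_pow_inv]
  have := h x y hx hxy hy
  omega

/-- The series of the element `τ^{-(n-i)} σ_i^{n-i}` becomes invariant under the finite Weyl group
after the action of `τ^{n-i}`. -/
theorem D_weylAct_foldr {i : ℕ} (hi : i < n) {l : List (ZMod n)}
    (hl : IsReducedWord l ((tau n ^ (n - i))⁻¹ * sigma n i ^ (n - i))) {a : ℤ} (h1 : 1 ≤ a)
    (h2 : a < n) :
    D (a : ZMod n) (weylAct (tau n ^ (n - i)) (l.foldr D 1)) =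
      weylAct (tau n ^ (n - i)) (l.foldr D 1) := by
  set m := n - i with hm
  have hsub : D (a : ZMod n) (weylAct (tau n ^ m) (l.foldr D 1)) =
      weylAct (tau n ^ m) (D ((a - m : ℤ) : ZMod n) (l.foldr D 1)) := by
    rw [weylAct_tau_pow_D]; push_cast; rw [sub_add_cancel]
  rw [hsub]
  refine congrArg (weylAct (tau n ^ m)) ?_
  have hs : s ((a - m : ℤ) : ZMod n) * (tau n ^ m)⁻¹ = (tau n ^ m)⁻¹ * s (a : ZMod n) := by
    have ht := tau_pow_mul_s m ((a - m : ℤ) : ZMod n)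
    rw [eq_inv_mul_iff_mul_eq, ← mul_assoc, ht, mul_inv_cancel_right]
    push_cast; rw [sub_add_cancel]
  -- At `a = i` the translation separates `i` from `i + 1`, which creates a left descent.
  by_cases hai : a = i
  · refine D_foldr_of_leftDescent hl ?_ 1
    rw [LeftDescent, mul_inv_rev, inv_inv, aff_mul_apply, aff_mul_apply, aff_tau_pow, aff_tau_pow,
      show a - (m : ℤ) + 1 + m = a + 1 by ring, sub_add_cancel, hm,
      aff_sigma_pow_sub_inv hi a h1 h2.le, aff_sigma_pow_sub_inv hi _ (by omega) (by omega),
      if_pos hai.le, if_neg (by omega)]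
    omega
  · by_cases hd : LeftDescent ((tau n ^ m)⁻¹ * sigma n i ^ m) (a - m)
    · exact D_foldr_of_leftDescent hl hd 1
    -- For `a ≠ i` the translation moves `a` and `a + 1` together and so commutes with `s_a`. Thus
    -- `D_{a-m}` in front of the word becomes `D_a` behind it, where it acts on `1` trivially.
    have hc : sigma n i ^ m * s (a : ZMod n) = s (a : ZMod n) * sigma n i ^ m := by
      by_cases hlt : a < i
      · refine mul_s_eq_s_mul (a := a) (c := a) rfl rfl ?_ ?_
        · rw [hm, aff_sigma_pow_sub hi a h1 h2.le, if_pos hlt.le]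
        · rw [hm, aff_sigma_pow_sub hi _ (by omega) (by omega), if_pos (by omega)]
      · refine mul_s_eq_s_mul (a := a) (c := a + n) rfl (by simp) ?_ ?_
        · rw [hm, aff_sigma_pow_sub hi a h1 h2.le, if_neg (by omega)]
        · rw [hm, aff_sigma_pow_sub hi _ (by omega) (by omega), if_neg (by omega)]; ring
    have hcons := hl.cons hd
    have happ : IsReducedWord (l ++ [(a : ZMod n)])
        (s ((a - m : ℤ) : ZMod n) * ((tau n ^ m)⁻¹ * sigma n i ^ m)) := by
      refine hcons.of_length_le ?_ (by simp)
      have e : wordProd l = (tau n ^ m)⁻¹ * sigma n i ^ m := hl.1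
      have e' : wordProd [(a : ZMod n)] = s (a : ZMod n) := by simp [wordProd]
      rw [wordProd_append, e, e', ← mul_assoc, hs, mul_assoc, mul_assoc, hc]
    have e1 : D (a : ZMod n) 1 = 1 := by
      have ha0 : (a : ZMod n) ≠ 0 := by
        have := intCast_ne_of_lt (n := n) (x := 0) (y := a) (by omega) (by omega)
        simpa using this.symm
      rw [D_eq_self_iff, weylAct_s, if_neg ha0, map_one, mul_one]
    have := foldr_D_eq hcons happ 1
    rwa [List.foldr_append, List.foldr_cons, List.foldr_cons, List.foldr_nil, e1] at this

end Rectangles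

end KSchur

/-! ### The factorization. -/

theorem theoremC {n : ℕ} [NeZero n] (i : ℕ) (hi : 1 ≤ i) (hin : i ≤ n - 1)
    (lam : KSchur.BoundedPartition (n - 1)) :
    KSchur.gTildePart (lam.union (KSchur.rectangle i hi hin)) =
      KSchur.gTildePart (KSchur.rectangle i hi hin) *
        KSchur.permSym (KSchur.rot n ^ i) (KSchur.gTildePart lam) := by
  open KSchur in
  have : Fact (1 < n) := ⟨by omega⟩
  have hin' : i < n := by omega
  have hlam : ∀ p ∈ lam.parts, p < n := fun p hp => by have := lam.le p hp; omega
  have hR : (xElt (rectangle i hi hin)).1 = (tau n ^ (n - i))⁻¹ * sigma n i ^ (n - i) := by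
    rw [xElt_eq, ← sigmaProd_replicate]
    change (tau n ^ (Multiset.replicate (n - i) i).card)⁻¹ *
      sigmaProd n ((Multiset.replicate (n - i) i).sort (· ≥ ·)) = _
    rw [Multiset.card_replicate, sort_eq_of_pairwise (L := List.replicate (n - i) i)
      (Multiset.coe_replicate _ _) (by simp [List.pairwise_replicate])]
  have hU : (xElt (lam.union (rectangle i hi hin))).1 =
      (tau n ^ (n - i))⁻¹ * (xElt lam).1 * sigma n i ^ (n - i) := by
    rw [xElt_eq, xElt_eq]
    change (tau n ^ (lam.parts + Multiset.replicate (n - i) i).card)⁻¹ *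
      sigmaProd n ((lam.parts + Multiset.replicate (n - i) i).sort (· ≥ ·)) = _
    rw [Multiset.card_add, Multiset.card_replicate, sigmaProd_sort_add_replicate _ hlam, pow_add,
      mul_inv_rev]
    simp only [mul_assoc]
  have hG : IsGrassmannian (xElt lam).1 := by
    rw [xElt_eq]
    exact (sigmaProd_window _ (Multiset.pairwise_sort _ _)
      fun p hp => hlam p (by simpa using hp)).1.tau_pow_inv_mul
  obtain ⟨l, hl⟩ := exists_isReducedWord (xElt lam)
  obtain ⟨l', hl'⟩ := exists_isReducedWord (xElt (rectangle i hi hin))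
  have hl'' := hl'
  rw [hR] at hl''
  have hred := isReducedWord_map_append hin' hG hl hl''
  rw [← hU] at hred
  have hinv := permSym_swap_eq_self fun a h1 h2 => D_weylAct_foldr hin' hl'' h1 h2
  rw [gTildePart, gTildePart, gTildePart, gTilde_eq hred, gTilde_eq hl, gTilde_eq hl']
  -- After `τ^{n-i}` the letters of `l` are no longer rotated, the rectangle factor is invariant,
  -- and the twist `ω^i` becomes `ω^n = 1`.
  apply weylAct_injective (tau n ^ (n - i))
  rw [List.foldr_append, weylAct_tau_pow_foldr, weylAct_mul_left, tau_pow_right, ← permSym_mul,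
    ← pow_add, Nat.sub_add_cancel hin'.le, rot_pow_self, permSym_one, ← foldr_D_mul_of_invariant hinv,
    mul_one]
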